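/- Let $0\le r<s$ be integers with $r\not\equiv s \pmod 3$, let $b_1,\dots,b_{s+r}\in\mathbb C$ be distinct, and put $k_s(x)=\prod_{i=1}^{s}(x-b_i)=\sum_j\lambda^{(s)}_jx^{s-j}$, $k_r(x)=\prod_{i=s+1}^{s+r}(x-b_i)=\sum_j\lambda^{(r)}_jx^{r-j}$, $k_s(x)k_r(x)=\sum_j\lambda^{(s+r)}_jx^{s+r-j}$. Let $X$ be the compact Riemann surface obtained by adding one point $\infty$ to the smooth affine space curve $$y^2=z\,k_r(x),\qquad yz=k_r(x)k_s(x),\qquad z^2=y\,k_s(x),$$ so that $x$ is a meromorphic function on $X$ whose only pole is $\infty$. Put $g=r+s-1$, $g_r=\lfloor (2s+r-1)/3\rfloor$, $g_s=\lfloor (2r+s-1)/3\rfloor$; then $g_r+g_s=g$. Let $\hat\phi_1,\dots,\hat\phi_g$ be the functions $x^ay$ $(0\le a<g_r)$ and $x^az$ $(0\le a<g_s)$, in any order, and put $\nu^I_i=\hat\phi_i\,dx/(3yz)$. For points $P,Q$ write $x_P=x(P)$, etc., and let $$\Sigma(P,Q)=\frac{y_Pz_P+y_Pz_Q+y_Qz_P}{3(x_P-x_Q)\,y_Pz_P}\,dx_P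 .$$ Here $d_Q\Sigma(P,Q)$ is $dx_P\otimes dx_Q$ times the derivative with respect to $x_Q$ of the coefficient of $dx_P$ in $\Sigma(P,Q)$, and $d_P\Sigma(Q,P)$ is obtained from it by exchanging $P$ and $Q$ (still written as a multiple of $dx_P\otimes dx_Q$). For meromorphic differentials $\nu_1,\dots,\nu_g$ on $X$ consider the relation $$d_Q\Sigma(P,Q)-d_P\Sigma(Q,P)=\sum_{i=1}^g\bigl(\nu^I_i(Q)\otimes\nu_i(P)-\nu^I_i(P)\otimes\nu_i(Q)\bigr).\tag{$*$}$$ 1. There exist differentials of the second kind $\nu^{II}_1,\dots,\nu^{II}_g$ on $X$, each having a pole at $\infty$ and no other pole, such that $(*)$ holds for $\nu_i=\nu^{II}_i$. 2. They are determined modulo the linear span of $\nu^I_1,\dots,\nu^I_g$: if $(\nu_i)$ and $(\nu'_i)$ are families of meromorphic differentials on $X$ that both satisfy $(*)$, then $\nu_i-\nu_i'\in\langle\nu^I_1,\dots,\nu^I_g\rangle$ for every $i$. 3. Explicit representatives are as follows. Define (empty sums are $0$) $$D^{(+)}(P,Q)=\sum_{j=0}^{s+r-2}\sum_{i=0}^{s+r-j-2}(i+1)\lambda^{(s+r)}_jx_P^{r+s-j-i-2}x_Q^i+\sum_{j=0}^{s-2}\sum_{i=0}^{s-j-2}\sum_{k=0}^r(i+1)\lambda^{(s)}_j\lambda^{(r)}_{r-k}x_P^{s-j-i-2}x_Q^{k+i},$$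 $$D^{(-)}(P,Q)=\sum_{j=0}^{s+r-2}\sum_{i=0}^{s+r-j-2}(i+1)\lambda^{(s+r)}_jx_Q^{r+s-j-i-2}x_P^i+\sum_{j=0}^{r-2}\sum_{i=0}^{r-j-2}\sum_{k=0}^s(i+1)\lambda^{(r)}_j\lambda^{(s)}_{s-k}x_Q^{r-j-i-2}x_P^{k+i},$$ $D_{r,s}(P,Q)=D^{(-)}(P,Q)-D^{(+)}(P,Q)$, and the polynomial $$\widehat D_{r,s}(P,Q)=y_Pz_Q\,D_{r,s}(P,Q)-y_Qz_P\,D_{r,s}(Q,P)$$ in $x_P,y_P,z_P,x_Q,y_Q,z_Q$. Let $\hat\pi_i(\widehat D_{r,s})$, a polynomial in $x_P,y_P,z_P$, be the coefficient in $\widehat D_{r,s}$ of the monomial $\hat\phi_i(Q)$, and let $c_{ij}\in\mathbb C$ be the coefficient of $\hat\phi_i(Q)\hat\phi_j(P)$. Then the differentials $$\tilde\nu_i=\frac{\hat\pi_i(\widehat D_{r,s})\,dx}{3yz}\qquad(i=1,\dots,g)$$ are of the second kind, have a pole at $\infty$ and no other pole, and represent the classes of part 2: $\nu_i-\tilde\nu_i\in\langle\nu^I_1,\dots,\nu^I_g\rangle$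 for every $i$ and every family $(\nu_i)$ satisfying $(*)$. Moreover the family $\tilde\nu_i-\tfrac12\sum_{j=1}^gc_{ij}\nu^I_j$ satisfies $(*)$ exactly. -/

import Mathlib

open scoped TensorProduct
open Polynomial

theorem isDomain_tensor_of_finiteType {k D A : Type*} [Field k] [IsAlgClosed k]
    [CommRing D] [IsDomain D] [Algebra k D] [Algebra.FiniteType k D]
    [CommRing A] [IsDomain A] [Algebra k A] : NoZeroDivisors (D ⊗[k] A) := by
  classical
  let 𝔟 := Module.Free.chooseBasis k A
  let 𝔠 := Algebra.TensorProduct.basis D 𝔟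
  refine ⟨fun {u v} huv => ?_⟩
  by_contra! hcon
  obtain ⟨hu, hv⟩ := hcon
  have hex : ∀ w : D ⊗[k] A, w ≠ 0 → ∃ i, 𝔠.repr w i ≠ 0 := by
    intro w hw
    by_contra! h
    exact hw (𝔠.repr.map_eq_zero_iff.mp (Finsupp.ext h))
  obtain ⟨i, hi⟩ := hex u hu
  obtain ⟨j, hj⟩ := hex v hv
  have : IsJacobsonRing D := isJacobsonRing_of_finiteType (A := k)
  have hjac : (⊥ : Ideal D).jacobson = ⊥ :=
    IsJacobsonRing.out inferInstance (Ideal.isPrime_bot (α := D)).isRadical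
  have hd : 𝔠.repr u i * 𝔠.repr v j ∉ (⊥ : Ideal D).jacobson := by
    rw [hjac, Ideal.mem_bot]; exact mul_ne_zero hi hj
  rw [Ideal.jacobson, Ideal.mem_sInf] at hd
  push Not at hd
  obtain ⟨m, ⟨-, hm⟩, hdm⟩ := hd
  let : Field (D ⧸ m) := Ideal.Quotient.field m
  have : Module.Finite k (D ⧸ m) := finite_of_finite_type_of_isJacobsonRing k (D ⧸ m)
  let e : k ≃ₐ[k] (D ⧸ m) := AlgEquiv.ofBijective (Algebra.ofId k (D ⧸ m))
    (IsAlgClosed.algebraMap_bijective_of_isIntegral (k := k) (K := D ⧸ m))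
  let φ : D →ₐ[k] k := (e.symm : (D ⧸ m) →ₐ[k] k).comp (Ideal.Quotient.mkₐ k m)
  have hφ : φ (𝔠.repr u i * 𝔠.repr v j) ≠ 0 := by
    intro h
    apply hdm
    have : Ideal.Quotient.mkₐ k m (𝔠.repr u i * 𝔠.repr v j) = 0 := by
      apply e.symm.injective
      rw [map_zero]; exact h
    exact Ideal.Quotient.eq_zero_iff_mem.mp this
  let ψ : D ⊗[k] A →ₐ[k] A :=
    Algebra.TensorProduct.lift ((Algebra.ofId k A).comp φ) (AlgHom.id k A)
      (fun _ _ => Commute.all _ _)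
  have hψ : ∀ (w : D ⊗[k] A) (l), 𝔟.repr (ψ w) l = φ (𝔠.repr w l) := by
    intro w l
    induction w with
    | zero => simp
    | add a b ha hb => simp [ha, hb]
    | tmul d a =>
      have h1 : ψ (d ⊗ₜ[k] a) = φ d • a := by simp [ψ, Algebra.ofId_apply, Algebra.smul_def]
      rw [h1, Algebra.TensorProduct.basis_repr_tmul]
      simp
  have h0 : ψ u * ψ v = 0 := by rw [← map_mul, huv, map_zero]
  rw [map_mul] at hφ
  rcases mul_eq_zero.mp h0 with h | h
  · exact (left_ne_zero_of_mul hφ) (by rw [← hψ, h]; simp)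
  · exact (right_ne_zero_of_mul hφ) (by rw [← hψ, h]; simp)

/-- The tensor product of two domains over an algebraically closed field is a domain. -/
theorem isDomain_tensor {k A B : Type*} [Field k] [IsAlgClosed k]
    [CommRing A] [IsDomain A] [Algebra k A] [CommRing B] [IsDomain B] [Algebra k B] :
    IsDomain (A ⊗[k] B) := by
  have : NoZeroDivisors (A ⊗[k] B) := by
    refine ⟨fun {u v} huv => ?_⟩
    obtain ⟨C, hC, u', hu⟩ := exists_fg_and_mem_baseChange u
    obtain ⟨C', hC', v', hv⟩ := exists_fg_and_mem_baseChange v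
    let E := C ⊔ C'
    have : Algebra.FiniteType k E := (E.fg_top).mpr (hC.sup hC') |> fun h => ⟨h⟩
    have hinj : Function.Injective (Algebra.TensorProduct.map (AlgHom.id k A) E.val) :=
      Module.Flat.lTensor_preserves_injective_linearMap E.val.toLinearMap Subtype.val_injective
    have := isDomain_tensor_of_finiteType (k := k) (D := E) (A := A)
    have : NoZeroDivisors (A ⊗[k] E) :=
      (Algebra.TensorProduct.comm k A E).injective.noZeroDivisors _ (map_zero _) (map_mul _)
    let u₁ := Algebra.TensorProduct.map (AlgHom.id k A) (Subalgebra.inclusion (le_sup_left : C ≤ E)) u'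
    let v₁ := Algebra.TensorProduct.map (AlgHom.id k A) (Subalgebra.inclusion (le_sup_right : C' ≤ E)) v'
    have hu₁ : Algebra.TensorProduct.map (AlgHom.id k A) E.val u₁ = u := by
      rw [← hu, ← AlgHom.comp_apply, ← Algebra.TensorProduct.map_comp]; rfl
    have hv₁ : Algebra.TensorProduct.map (AlgHom.id k A) E.val v₁ = v := by
      rw [← hv, ← AlgHom.comp_apply, ← Algebra.TensorProduct.map_comp]; rfl
    have : u₁ * v₁ = 0 := hinj (by rw [map_mul, hu₁, hv₁, huv, map_zero])
    rcases mul_eq_zero.mp this with h | h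
    · left; rw [← hu₁, h, map_zero]
    · right; rw [← hv₁, h, map_zero]
  have : Nontrivial (A ⊗[k] B) := inferInstance
  exact NoZeroDivisors.to_isDomain _

/-- The data of a cyclic trigonal curve with `Z/3`-equations
`y_r^3 = k_r^2 k_s`, `y_s^3 = k_s^2 k_r`, where `deg k_s = s > r = deg k_r`, the `s + r` branch
points are distinct, and `s - r` is prime to `3` (so that there is a single point at infinity and
`3, 2r+s, 2s+r` generate a numerical semigroup). -/
structure TrigonalCurve where
  r : ℕ
  s : ℕ
  lt : r < s
  mod : ¬ r ≡ s [MOD 3]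
  /-- the branch points: `inl` the `s` roots of `k_s`, `inr` the `r` roots of `k_r` -/
  b : Fin s ⊕ Fin r → ℂ
  inj : Function.Injective b

namespace TrigonalCurve

variable (C : TrigonalCurve)

/-- `k_s(x) = (x - b_1) ⋯ (x - b_s)`. -/
noncomputable def ks : ℂ[X] := ∏ i : Fin C.s, (X - Polynomial.C (C.b (.inl i)))

/-- `k_r(x) = (x - b_{s+1}) ⋯ (x - b_{s+r})`. -/
noncomputable def kr : ℂ[X] := ∏ i : Fin C.r, (X - Polynomial.C (C.b (.inr i)))

/-- The polynomial `Y ^ 3 - k_r ^ 2 k_s` over `ℂ(x)`. -/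
noncomputable def eqn : (RatFunc ℂ)[X] :=
  X ^ 3 - Polynomial.C (algebraMap ℂ[X] (RatFunc ℂ) (C.kr ^ 2 * C.ks))

theorem eqn_irreducible : Irreducible C.eqn := by
  apply X_pow_sub_C_irreducible_of_prime Nat.prime_three
  intro c hc
  have hint : IsIntegral ℂ[X] c := by
    refine ⟨X ^ 3 - Polynomial.C (C.kr ^ 2 * C.ks), monic_X_pow_sub_C _ (by norm_num), ?_⟩
    simp [hc]
  obtain ⟨p, rfl⟩ := IsIntegrallyClosed.isIntegral_iff.mp hint
  rw [← map_pow] at hc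
  have hp := IsFractionRing.injective ℂ[X] (RatFunc ℂ) hc
  have hs : 0 < C.s := by have := C.lt; omega
  have hks : C.ks ≠ 0 := Finset.prod_ne_zero_iff.mpr fun i _ => X_sub_C_ne_zero _
  have hkr : C.kr ≠ 0 := Finset.prod_ne_zero_iff.mpr fun i _ => X_sub_C_ne_zero _
  let β := C.b (.inl ⟨0, hs⟩)
  have h1 : rootMultiplicity β C.kr = 0 := by
    apply rootMultiplicity_eq_zero
    rw [kr, IsRoot, eval_prod, Finset.prod_eq_zero_iff]
    rintro ⟨i, -, hi⟩
    rw [eval_sub, eval_X, eval_C, sub_eq_zero] at hi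
    exact absurd (C.inj hi) (by simp)
  have h2 : rootMultiplicity β C.ks = 1 := by
    have hq : ∏ i ∈ Finset.univ.erase (⟨0, hs⟩ : Fin C.s), (X - Polynomial.C (C.b (.inl i))) ≠ 0 :=
      Finset.prod_ne_zero_iff.mpr fun i _ => X_sub_C_ne_zero _
    have he : C.ks = (X - Polynomial.C β) *
        ∏ i ∈ Finset.univ.erase (⟨0, hs⟩ : Fin C.s), (X - Polynomial.C (C.b (.inl i))) :=
      (Finset.mul_prod_erase _ _ (Finset.mem_univ _)).symm
    rw [he, rootMultiplicity_mul (mul_ne_zero (X_sub_C_ne_zero _) hq),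
      rootMultiplicity_X_sub_C_self, rootMultiplicity_eq_zero]
    rw [IsRoot, eval_prod, Finset.prod_eq_zero_iff]
    rintro ⟨i, hi, h⟩
    rw [eval_sub, eval_X, eval_C, sub_eq_zero] at h
    have := C.inj h
    simp at this
    simp [this] at hi
  have h3 := congrArg (rootMultiplicity β) hp
  have hp0 : p ≠ 0 := by
    rintro rfl
    rw [zero_pow (by norm_num)] at hp
    exact mul_ne_zero (pow_ne_zero 2 hkr) hks hp.symm
  have hpow : ∀ (q : ℂ[X]) (n : ℕ), rootMultiplicity β (q ^ n) = n * rootMultiplicity β q := by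
    intro q n
    rw [← count_roots, ← count_roots, roots_pow, Multiset.count_nsmul]
  rw [rootMultiplicity_mul (mul_ne_zero (pow_ne_zero 2 hkr) hks), hpow, hpow, h1, h2] at h3
  omega

instance : Fact (Irreducible C.eqn) := ⟨C.eqn_irreducible⟩

/-- The field of meromorphic functions of the curve `X`, that is `ℂ(x)[Y] / (Y ^ 3 - k_r ^ 2 k_s)`. -/
abbrev K : Type := AdjoinRoot C.eqn

/-- The coordinate functions `x`, `y = y_{2r+s}` and `z = y_{2s+r}`. -/
noncomputable def x : C.K := algebraMap (RatFunc ℂ) C.K RatFunc.X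

noncomputable def y : C.K := AdjoinRoot.root C.eqn

noncomputable def z : C.K := C.y ^ 2 / aeval C.x C.kr

theorem aeval_x (p : ℂ[X]) :
    aeval C.x p = algebraMap (RatFunc ℂ) C.K (algebraMap ℂ[X] (RatFunc ℂ) p) := by
  have h : C.x = algebraMap (RatFunc ℂ) C.K (algebraMap ℂ[X] (RatFunc ℂ) X) := by
    rw [RatFunc.algebraMap_X]; rfl
  rw [h, aeval_algebraMap_apply, aeval_algebraMap_apply, aeval_X_left_apply]

theorem aeval_x_ne_zero {p : ℂ[X]} (hp : p ≠ 0) : aeval C.x p ≠ 0 := by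
  rw [aeval_x]
  simpa using hp

theorem kr_ne_zero : C.kr ≠ 0 := Finset.prod_ne_zero_iff.mpr fun _ _ => X_sub_C_ne_zero _

theorem ks_ne_zero : C.ks ≠ 0 := Finset.prod_ne_zero_iff.mpr fun _ _ => X_sub_C_ne_zero _

theorem y_pow_three : C.y ^ 3 = aeval C.x C.kr ^ 2 * aeval C.x C.ks := by
  have h : eval₂ (AdjoinRoot.of C.eqn) (AdjoinRoot.root C.eqn)
      (X ^ 3 - Polynomial.C (algebraMap ℂ[X] (RatFunc ℂ) (C.kr ^ 2 * C.ks))) = 0 :=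
    AdjoinRoot.eval₂_root C.eqn
  rw [← map_pow, ← map_mul, aeval_x]
  simp only [eval₂_sub, eval₂_pow, eval₂_X, eval₂_C] at h
  exact sub_eq_zero.mp h

/-- The three equations of the space curve. -/
theorem y_sq : C.y ^ 2 = C.z * aeval C.x C.kr := by
  rw [z, div_mul_cancel₀ _ (C.aeval_x_ne_zero C.kr_ne_zero)]

theorem y_mul_z : C.y * C.z = aeval C.x C.kr * aeval C.x C.ks := by
  have h := C.aeval_x_ne_zero C.kr_ne_zero
  rw [z, mul_div_assoc', div_eq_iff h, ← pow_succ', C.y_pow_three]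
  ring

theorem z_sq : C.z ^ 2 = C.y * aeval C.x C.ks := by
  have h := C.aeval_x_ne_zero C.kr_ne_zero
  rw [z, div_pow, div_eq_iff (pow_ne_zero 2 h)]
  linear_combination C.y * C.y_pow_three

/-! ### Differentials on `X` -/

/-- The meromorphic differential `dx`. -/
noncomputable def dx : Ω[C.K⁄ℂ] := KaehlerDifferential.D ℂ C.K C.x

/-- The points of the compact Riemann surface `X`, as the places of its field of meromorphic
functions: the nontrivial valuation rings containing the constants. The place is the point `∞` if
`x` is not in the valuation ring (`x` has a pole), and a point of the affine curve otherwise. -/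
def IsPlace (V : ValuationSubring C.K) : Prop :=
  (∀ c : ℂ, algebraMap ℂ C.K c ∈ V) ∧ V ≠ ⊤

/-- The differential `ω` has no pole at the place `V`: it lies in the module of differentials
`∑ f dg` with `f, g` regular at `V`. -/
def IsRegularAt (V : ValuationSubring C.K) (ω : Ω[C.K⁄ℂ]) : Prop :=
  ω ∈ Submodule.span V {η : Ω[C.K⁄ℂ] | ∃ f ∈ V, η = KaehlerDifferential.D ℂ C.K f}

/-- Differentials of the second kind: at each point `ω` is, up to a differential without pole there,
the differential of a meromorphic function (equivalently, all residues vanish). -/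
def IsSecondKind (ω : Ω[C.K⁄ℂ]) : Prop :=
  ∀ V, C.IsPlace V → ∃ f : C.K, C.IsRegularAt V (ω - KaehlerDifferential.D ℂ C.K f)

/-- `ω` has a pole at `∞` and no other pole. -/
def HasOnlyPoleAtInfinity (ω : Ω[C.K⁄ℂ]) : Prop :=
  ∀ V, C.IsPlace V → (C.IsRegularAt V ω ↔ C.x ∈ V)

/-- The genus `g = r + s - 1`. -/
def g : ℕ := C.r + C.s - 1

/-- `g_r = ⌊(2s + r - 1) / 3⌋`, the number of the functions `x ^ i y` below. -/
def gr : ℕ := (2 * C.s + C.r - 1) / 3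

/-- `g_s = ⌊(2r + s - 1) / 3⌋`, the number of the functions `x ^ i z` below. -/
def gs : ℕ := (2 * C.r + C.s - 1) / 3

/-- The index set of the functions `φ̂`: `inl i` stands for `x ^ i y` with `i < g_r` and `inr i` for
`x ^ i z` with `i < g_s`. -/
abbrev Idx : Type := Fin C.gr ⊕ Fin C.gs

theorem card_idx : Fintype.card C.Idx = C.g := by
  have h1 := C.lt
  have h2 := C.mod
  simp only [Nat.ModEq] at h2
  change Fintype.card (Fin C.gr ⊕ Fin C.gs) = C.g
  rw [Fintype.card_sum, Fintype.card_fin, Fintype.card_fin, gr, gs, g]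
  omega

/-- The monomials `φ̂` in the variables `x, y, z` (numbered `0, 1, 2`), as exponents. -/
noncomputable def phiMono : C.Idx → (Fin 3 →₀ ℕ)
  | .inl i => Finsupp.single 0 (i : ℕ) + Finsupp.single 1 1
  | .inr i => Finsupp.single 0 (i : ℕ) + Finsupp.single 2 1

/-- A polynomial in `x, y, z` as a function on `X`. -/
noncomputable def toFun : MvPolynomial (Fin 3) ℂ →ₐ[ℂ] C.K := MvPolynomial.aeval ![C.x, C.y, C.z]

/-- The functions `φ̂` on `X`. -/
noncomputable def phiHat (i : C.Idx) : C.K := C.toFun (MvPolynomial.monomial (C.phiMono i) 1)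

/-- `ν^I = φ̂ dx / (3 y z)`; first its coefficient with respect to `dx`. -/
noncomputable def nuICoeff (i : C.Idx) : C.K := C.phiHat i / (3 * C.y * C.z)

noncomputable def nuI (i : C.Idx) : Ω[C.K⁄ℂ] := C.nuICoeff i • C.dx

/-! ### Functions and differentials on `X × X` -/

instance : IsDomain (C.K ⊗[ℂ] C.K) := isDomain_tensor

/-- The field of meromorphic functions of `X × X`, with points written `(P, Q)`. -/
abbrev K₂ : Type := FractionRing (C.K ⊗[ℂ] C.K)

/-- `f ↦ f(P)`. -/
noncomputable def atP : C.K →ₐ[ℂ] C.K₂ :=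
  (IsScalarTower.toAlgHom ℂ (C.K ⊗[ℂ] C.K) C.K₂).comp Algebra.TensorProduct.includeLeft

/-- `f ↦ f(Q)`. -/
noncomputable def atQ : C.K →ₐ[ℂ] C.K₂ :=
  (IsScalarTower.toAlgHom ℂ (C.K ⊗[ℂ] C.K) C.K₂).comp Algebra.TensorProduct.includeRight

/-- The exchange of `P` and `Q`. -/
noncomputable def swap : C.K₂ ≃+* C.K₂ :=
  IsFractionRing.ringEquivOfRingEquiv (Algebra.TensorProduct.comm ℂ C.K C.K).toRingEquiv

/-- The structure of `C.K`-algebra on `C.K₂` is the one by functions of `P`. -/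
theorem algebraMap_eq_atP (f : C.K) : algebraMap C.K C.K₂ f = C.atP f := rfl

theorem swap_atP (f : C.K) : C.swap (C.atP f) = C.atQ f := by
  change C.swap (algebraMap (C.K ⊗[ℂ] C.K) C.K₂ (f ⊗ₜ 1)) = algebraMap (C.K ⊗[ℂ] C.K) C.K₂ (1 ⊗ₜ f)
  simp [swap]

theorem swap_atQ (f : C.K) : C.swap (C.atQ f) = C.atP f := by
  change C.swap (algebraMap (C.K ⊗[ℂ] C.K) C.K₂ (1 ⊗ₜ f)) = algebraMap (C.K ⊗[ℂ] C.K) C.K₂ (f ⊗ₜ 1)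
  simp [swap]

/-- `c = ∂f/∂x_Q`: the relative differential of `f`, the functions of `P` being constants, is
`c dx_Q`. (The relative differentials form a one-dimensional space spanned by `dx_Q`.) -/
def HasPartialQ (f c : C.K₂) : Prop :=
  KaehlerDifferential.D C.K C.K₂ f = c • KaehlerDifferential.D C.K C.K₂ (C.atQ C.x)

/-- `Σ(P, Q) = sigma dx_P`. -/
noncomputable def sigma : C.K₂ :=
  (C.atP C.y * C.atP C.z + C.atP C.y * C.atQ C.z + C.atQ C.y * C.atP C.z) /
    (3 * (C.atP C.x - C.atQ C.x) * C.atP C.y * C.atP C.z)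

/-- The relation
`d_Q Σ(P, Q) - d_P Σ(Q, P) = ∑ (ν^I_i(Q) ⊗ ν_i(P) - ν^I_i(P) ⊗ ν_i(Q))`
between differentials on `X × X`, as the equality of the coefficients of `dx_P ⊗ dx_Q`:
`ν_i = h_i dx`, `d_Q Σ(P, Q) = c dx_P ⊗ dx_Q`, and so `d_P Σ(Q, P) = swap c dx_P ⊗ dx_Q`. -/
def DSigmaRelation (ν : C.Idx → Ω[C.K⁄ℂ]) : Prop :=
  ∃ (h : C.Idx → C.K) (c : C.K₂), (∀ i, ν i = h i • C.dx) ∧ C.HasPartialQ C.sigma c ∧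
    c - C.swap c = ∑ i, (C.atQ (C.nuICoeff i) * C.atP (h i) - C.atP (C.nuICoeff i) * C.atQ (h i))

/-! ### The polynomial `D̂` -/

/-- `λ^{(s)}_j`, the coefficient of `x ^ (s - j)` in `k_s`. -/
noncomputable def lams (j : ℕ) : ℂ := C.ks.coeff (C.s - j)

/-- `λ^{(r)}_j`, the coefficient of `x ^ (r - j)` in `k_r`. -/
noncomputable def lamr (j : ℕ) : ℂ := C.kr.coeff (C.r - j)

/-- `λ^{(s+r)}_j`, the coefficient of `x ^ (s + r - j)` in `k_s k_r`. -/
noncomputable def lamsr (j : ℕ) : ℂ := (C.ks * C.kr).coeff (C.s + C.r - j)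

section

variable {A : Type} [CommRing A] [Algebra ℂ A]

/-- `D^{(+)}(P, Q)`, a polynomial in `p = x_P` and `q = x_Q`. -/
noncomputable def Dplus (p q : A) : A :=
  ∑ j ∈ Finset.range (C.s + C.r - 1), ∑ i ∈ Finset.range (C.s + C.r - j - 1),
      (((i : ℂ) + 1) * C.lamsr j) • (p ^ (C.r + C.s - j - i - 2) * q ^ i) +
    ∑ j ∈ Finset.range (C.s - 1), ∑ i ∈ Finset.range (C.s - j - 1),
      ∑ k ∈ Finset.range (C.r + 1),
        (((i : ℂ) + 1) * C.lams j * C.lamr (C.r - k)) • (p ^ (C.s - j - i - 2) * q ^ (k + i))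

/-- `D^{(-)}(P, Q)`. -/
noncomputable def Dminus (p q : A) : A :=
  ∑ j ∈ Finset.range (C.s + C.r - 1), ∑ i ∈ Finset.range (C.s + C.r - j - 1),
      (((i : ℂ) + 1) * C.lamsr j) • (q ^ (C.r + C.s - j - i - 2) * p ^ i) +
    ∑ j ∈ Finset.range (C.r - 1), ∑ i ∈ Finset.range (C.r - j - 1),
      ∑ k ∈ Finset.range (C.s + 1),
        (((i : ℂ) + 1) * C.lamr j * C.lams (C.s - k)) • (q ^ (C.r - j - i - 2) * p ^ (k + i))

/-- `D(P, Q) = D^{(-)}(P, Q) - D^{(+)}(P, Q)`. -/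
noncomputable def Drs (p q : A) : A := C.Dminus p q - C.Dplus p q

end

/-- `D̂(P, Q) = y_P z_Q D(P, Q) - y_Q z_P D(Q, P)`, as a polynomial in `x_Q, y_Q, z_Q` whose
coefficients are polynomials in `x_P, y_P, z_P`. -/
noncomputable def Dhat : MvPolynomial (Fin 3) (MvPolynomial (Fin 3) ℂ) :=
  let xP : MvPolynomial (Fin 3) (MvPolynomial (Fin 3) ℂ) := MvPolynomial.C (MvPolynomial.X 0)
  let yP : MvPolynomial (Fin 3) (MvPolynomial (Fin 3) ℂ) := MvPolynomial.C (MvPolynomial.X 1)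
  let zP : MvPolynomial (Fin 3) (MvPolynomial (Fin 3) ℂ) := MvPolynomial.C (MvPolynomial.X 2)
  let xQ : MvPolynomial (Fin 3) (MvPolynomial (Fin 3) ℂ) := MvPolynomial.X 0
  let yQ : MvPolynomial (Fin 3) (MvPolynomial (Fin 3) ℂ) := MvPolynomial.X 1
  let zQ : MvPolynomial (Fin 3) (MvPolynomial (Fin 3) ℂ) := MvPolynomial.X 2
  yP * zQ * C.Drs xP xQ - yQ * zP * C.Drs xQ xP

/-- `π̂_i(D̂)`, the coefficient of `φ̂_i(Q)` in `D̂`, a polynomial in `x_P, y_P, z_P`. -/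
noncomputable def piHat (i : C.Idx) : MvPolynomial (Fin 3) ℂ := C.Dhat.coeff (C.phiMono i)

/-- The coefficient of `φ̂_i(Q) φ̂_j(P)` in `D̂`. -/
noncomputable def piHat₂ (i j : C.Idx) : ℂ := (C.piHat i).coeff (C.phiMono j)

/-- The explicit representatives `π̂_i(D̂) dx / (3 y z)`. -/
noncomputable def nuRep (i : C.Idx) : Ω[C.K⁄ℂ] := (C.toFun (C.piHat i) / (3 * C.y * C.z)) • C.dx

end TrigonalCurve

/-!
The proof is algebraic. The field `K` of functions on `X` is formally étale over `ℂ[x]`, so that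
`Ω[K⁄ℂ]` is free of rank one over `K` with basis `dx`, and the derivation `d/dx` of `K` extends to
the derivation `∂/∂x_Q` of `K₂`.

*The relation.* The logarithmic derivatives of `y = ∛(k_r² k_s)` and `z = ∛(k_s² k_r)` are rational
functions of `x`, whence an explicit formula for the derivative of `Σ(P, Q)`. The sums that define
`D` are `∂/∂q` of the divided differences `(k(p) - k(q)) / (p - q)` for `k` one of `k_s k_r`, `k_s`
and `k_r`, which gives the closed form `sq_sub_mul_Drs` for `(p - q)² D`. Comparing the two, the
left side of the relation is `D̂ / (9 y_P z_P y_Q z_Q)` (`sigmaDeriv_sub_swap`). As `D` has degree at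
most `r + s - 2 = g_r + g_s - 1`, each monomial of `D̂`, a function of `P` times a function of `Q`,
has some `φ̂_i` as one of these factors; since `D̂` is antisymmetric, collecting the monomials
yields the relation for `ν̃_i - ½ ∑ c_ij ν^I_j` (`sum_phiVal_mul_sub`).

*Uniqueness.* The difference `v_i dx` of two solutions satisfies `∑ v_i ⊗ u_i = ∑ u_i ⊗ v_i` with
the linearly independent coefficients `u_i` of the `ν^I_i`; apply a linear form dual to `u_j`
(`mem_span_of_sum_tmul_eq`).

*Poles.* Each `ν̃_i` is `P(x) dx / u` with a polynomial `P` and `u = y` or `u = z`. On the affine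
curve `dx / u` is regular, because `y` or `z` is a local parameter at a branch point
(`IsRadicalPair.isRegularAt_of_mem`). At infinity the valuations of functions with a rational cube
are determined by degrees. Put `u³ = M(x)`, with `deg M` prime to `3`. Then `d(x^k / u)` is
`x^(k-1) dx / u` times a function with value `(3 k - deg M) / 3 ≠ 0` at infinity, and so
`P(x) dx / u` becomes regular after subtracting exact differentials
(`IsRadicalPair.exists_isRegularAt_sub_D`). It is not regular if `3 deg P + 3 ≥ deg M`, because
`x d/dx` maps functions regular at infinity to functions vanishing there
(`IsRadicalPair.not_isRegularAt`). The bound holds for `ν̃_i` because the coefficient of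
`x_P^m x_Q^n` in `D` is `s + 2 r - 3 (n + 1)` in the top degree `m + n = r + s - 2`, which is nonzero
as `r` and `s` are incongruent modulo `3` (`drsCoeff_top_ne_zero`).
-/

open scoped TensorProduct
open Polynomial

namespace TrigonalCurve

variable (C : TrigonalCurve)

/-! ### Derivations of the two function fields -/

instance : CharZero C.K := charZero_of_injective_algebraMap (algebraMap ℂ C.K).injective

instance : CharZero C.K₂ := charZero_of_injective_algebraMap (algebraMap C.K C.K₂).injective

theorem algebraMap_polynomial_eq_aeval (p : ℂ[X]) : algebraMap ℂ[X] C.K p = aeval C.x p := by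
  rw [aeval_x, IsScalarTower.algebraMap_apply ℂ[X] (RatFunc ℂ) C.K]

theorem eqn_monic : C.eqn.Monic := monic_X_pow_sub_C _ (by norm_num)

instance : FiniteDimensional (RatFunc ℂ) C.K := C.eqn_monic.finite_adjoinRoot

/-- The function field is a separable extension of a localization of `ℂ[x]`. -/
instance : Algebra.FormallyEtale ℂ[X] C.K := by
  have : Algebra.FormallyEtale ℂ[X] (RatFunc ℂ) :=
    Algebra.FormallyEtale.of_isLocalization (nonZeroDivisors ℂ[X])
  have : Algebra.FormallyEtale (RatFunc ℂ) C.K := Algebra.FormallyEtale.of_isSeparable _ _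
  exact Algebra.FormallyEtale.comp ℂ[X] (RatFunc ℂ) C.K

/-- The coefficient `ω / dx` of a differential `ω` on `X`. -/
noncomputable def coeffDx : Ω[C.K⁄ℂ] ≃ₗ[C.K] C.K :=
  (KaehlerDifferential.tensorKaehlerEquivOfFormallyEtale ℂ ℂ[X] C.K).symm ≪≫ₗ
    (LinearEquiv.baseChange ℂ[X] C.K _ _ (KaehlerDifferential.polynomialEquiv ℂ)) ≪≫ₗ
      TensorProduct.AlgebraTensorModule.rid ℂ[X] C.K C.K

theorem coeffDx_dx : C.coeffDx C.dx = 1 := by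
  have h : C.x = algebraMap ℂ[X] C.K X := by rw [algebraMap_polynomial_eq_aeval, aeval_X]
  simp only [coeffDx, dx, LinearEquiv.trans_apply]
  rw [h, KaehlerDifferential.tensorKaehlerEquivOfFormallyEtale_symm_D_algebraMap]
  simp

theorem coeffDx_smul_dx (ω : Ω[C.K⁄ℂ]) : C.coeffDx ω • C.dx = ω := by
  apply C.coeffDx.injective
  rw [map_smul, coeffDx_dx, smul_eq_mul, mul_one]

/-- The derivation `d/dx` of the function field. -/
noncomputable def ddx : Derivation ℂ C.K C.K :=
  C.coeffDx.toLinearMap.compDer (KaehlerDifferential.D ℂ C.K)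

theorem ddx_x : C.ddx C.x = 1 := C.coeffDx_dx

theorem D_eq_ddx (f : C.K) : KaehlerDifferential.D ℂ C.K f = C.ddx f • C.dx :=
  (C.coeffDx_smul_dx _).symm

theorem ddx_aeval (p : ℂ[X]) : C.ddx (aeval C.x p) = aeval C.x (derivative p) := by
  rw [Derivation.map_aeval, ddx_x, smul_eq_mul, mul_one]

/-- The derivation `id ⊗ d/dx` of `K ⊗ K`, with functions of `P` as constants. -/
noncomputable def ddxTensor : Derivation C.K (C.K ⊗[ℂ] C.K) (C.K ⊗[ℂ] C.K) :=
  Derivation.mk' (LinearMap.baseChange C.K (C.ddx : C.K →ₗ[ℂ] C.K)) (by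
    intro a b
    induction a with
    | zero => simp
    | add a a' ha ha' => rw [add_mul, map_add, ha, ha', map_add, add_smul, smul_add]; abel
    | tmul f g =>
      induction b with
      | zero => simp
      | add b b' hb hb' => rw [mul_add, map_add, hb, hb', map_add, add_smul, smul_add]; abel
      | tmul f' g' =>
        simp [TensorProduct.tmul_add, mul_comm f' f])

/-- The partial derivative `∂/∂x_Q` as a linear form on the relative differentials. -/
theorem exists_linearMap_D_atQ :
    ∃ ℓ : Ω[C.K₂⁄C.K] →ₗ[C.K₂] C.K₂,
      ∀ f : C.K, ℓ (KaehlerDifferential.D C.K C.K₂ (C.atQ f)) = C.atQ (C.ddx f) := by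
  have : Algebra.FormallyEtale (C.K ⊗[ℂ] C.K) C.K₂ :=
    Algebra.FormallyEtale.of_isLocalization (nonZeroDivisors _)
  let ℓ₀ : Ω[C.K ⊗[ℂ] C.K⁄C.K] →ₗ[C.K ⊗[ℂ] C.K] C.K₂ :=
    (Algebra.linearMap (C.K ⊗[ℂ] C.K) C.K₂).comp C.ddxTensor.liftKaehlerDifferential
  refine ⟨(LinearMap.liftBaseChange C.K₂ ℓ₀).comp
    (KaehlerDifferential.tensorKaehlerEquivOfFormallyEtale C.K
      (C.K ⊗[ℂ] C.K) C.K₂).symm.toLinearMap, ?_⟩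
  intro f
  change (LinearMap.liftBaseChange C.K₂ ℓ₀)
    ((KaehlerDifferential.tensorKaehlerEquivOfFormallyEtale C.K (C.K ⊗[ℂ] C.K) C.K₂).symm
      (KaehlerDifferential.D C.K C.K₂ (algebraMap (C.K ⊗[ℂ] C.K) C.K₂ (1 ⊗ₜ f)))) =
        algebraMap (C.K ⊗[ℂ] C.K) C.K₂ (1 ⊗ₜ C.ddx f)
  rw [KaehlerDifferential.tensorKaehlerEquivOfFormallyEtale_symm_D_algebraMap]
  simp [ℓ₀, ddxTensor]

/-- Partial derivatives are unique because `dx_Q ≠ 0`. -/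
theorem hasPartialQ_unique {f c c' : C.K₂} (h : C.HasPartialQ f c) (h' : C.HasPartialQ f c') :
    c = c' := by
  obtain ⟨ℓ, hℓ⟩ := C.exists_linearMap_D_atQ
  have := congrArg ℓ (h.symm.trans h')
  simpa [hℓ, ddx_x] using this

theorem ddx_of_pow_three {u : C.K} {M : ℂ[X]} (hM : M ≠ 0) (hu : u ^ 3 = aeval C.x M) :
    C.ddx u = u * aeval C.x (derivative M) / (3 * aeval C.x M) := by
  have hM' := C.aeval_x_ne_zero hM
  have h := congrArg C.ddx hu
  rw [Derivation.leibniz_pow, ddx_aeval] at h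
  simp only [smul_eq_mul, nsmul_eq_mul] at h
  push_cast at h
  rw [eq_div_iff (by simpa using hM'), ← h, ← hu]
  ring

theorem D_atQ_aeval (p : ℂ[X]) : KaehlerDifferential.D C.K C.K₂ (C.atQ (aeval C.x p)) =
    C.atQ (aeval C.x (derivative p)) • KaehlerDifferential.D C.K C.K₂ (C.atQ C.x) := by
  have h := Derivation.map_aeval ((KaehlerDifferential.D C.K C.K₂).restrictScalars ℂ) p (C.atQ C.x)
  rw [aeval_algHom_apply, aeval_algHom_apply] at h
  exact h

theorem D_atQ_of_pow_three {u : C.K} {M : ℂ[X]} (hM : M ≠ 0) (hu : u ^ 3 = aeval C.x M) :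
    KaehlerDifferential.D C.K C.K₂ (C.atQ u) =
      C.atQ (C.ddx u) • KaehlerDifferential.D C.K C.K₂ (C.atQ C.x) := by
  have hM' := C.aeval_x_ne_zero hM
  have hu0 : u ≠ 0 := by rintro rfl; simp at hu; exact hM' hu.symm
  have hq : C.atQ u ≠ 0 := by simpa using hu0
  have h : KaehlerDifferential.D C.K C.K₂ (C.atQ u ^ 3) =
      C.atQ (aeval C.x (derivative M)) • KaehlerDifferential.D C.K C.K₂ (C.atQ C.x) := by
    rw [← map_pow, hu, D_atQ_aeval]
  rw [Derivation.leibniz_pow, ← Nat.cast_smul_eq_nsmul C.K₂, smul_smul] at h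
  have h3 : ((3 : ℕ) : C.K₂) * C.atQ u ^ (3 - 1) ≠ 0 :=
    mul_ne_zero (by norm_num) (pow_ne_zero _ hq)
  apply smul_right_injective _ h3
  simp only [h, smul_smul]
  congr 1
  rw [ddx_of_pow_three C hM hu, ← hu]
  simp only [map_div₀, map_mul, map_pow, map_ofNat]
  field_simp
  push_cast
  ring

theorem D_atP (f : C.K) : KaehlerDifferential.D C.K C.K₂ (C.atP f) = 0 :=
  Derivation.map_algebraMap _ f

/-! ### Valuations of functions at a pole of `x` -/

section Infinity

variable {C} {V : ValuationSubring C.K}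

theorem one_lt_valuation_x (hx : C.x ∉ V) : 1 < V.valuation C.x := by
  rwa [← not_le, V.valuation_le_one_iff]

theorem valuation_algebraMap_le (hV : C.IsPlace V) (c : ℂ) :
    V.valuation (algebraMap ℂ C.K c) ≤ 1 :=
  (V.valuation_le_one_iff _).mpr (hV.1 c)

theorem valuation_algebraMap (hV : C.IsPlace V) {c : ℂ} (hc : c ≠ 0) :
    V.valuation (algebraMap ℂ C.K c) = 1 := by
  refine le_antisymm (valuation_algebraMap_le hV c) ?_
  have h := valuation_algebraMap_le hV c⁻¹
  rw [map_inv₀, map_inv₀] at h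
  have h0 : 0 < V.valuation (algebraMap ℂ C.K c) := by
    rw [zero_lt_iff, ne_eq, map_eq_zero, map_eq_zero]
    exact hc
  exact (inv_le_one₀ h0).mp h

theorem valuation_aeval_le (hV : C.IsPlace V) (hx : C.x ∉ V) {p : ℂ[X]} {n : ℕ}
    (hp : p.natDegree ≤ n) : V.valuation (aeval C.x p) ≤ V.valuation C.x ^ n := by
  rw [aeval_eq_sum_range]
  refine Valuation.map_sum_le _ fun i hi => ?_
  rw [Algebra.smul_def, map_mul, map_pow]
  calc _ ≤ 1 * V.valuation C.x ^ i := by gcongr; exact valuation_algebraMap_le hV _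
    _ ≤ _ := by
      rw [one_mul]
      exact pow_le_pow_right₀ (one_lt_valuation_x hx).le
        ((Nat.lt_succ_iff.mp (Finset.mem_range.mp hi)).trans hp)

theorem valuation_aeval (hV : C.IsPlace V) (hx : C.x ∉ V) {p : ℂ[X]} (hp : p ≠ 0) :
    V.valuation (aeval C.x p) = V.valuation C.x ^ p.natDegree := by
  have hlead : V.valuation (aeval C.x (monomial p.natDegree p.leadingCoeff)) =
      V.valuation C.x ^ p.natDegree := by
    rw [aeval_monomial, map_mul, map_pow, valuation_algebraMap hV (leadingCoeff_ne_zero.mpr hp),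
      one_mul]
  have hsplit := congrArg (aeval C.x) p.eraseLead_add_monomial_natDegree_leadingCoeff
  rw [map_add] at hsplit
  rw [← hsplit]
  rcases eq_or_ne p.eraseLead 0 with h | h
  · rw [h, map_zero, zero_add, hlead]
  · rw [Valuation.map_add_eq_of_lt_right, hlead]
    rw [hlead]
    refine (valuation_aeval_le hV hx le_rfl).trans_lt ?_
    exact pow_lt_pow_right₀ (one_lt_valuation_x hx)
      (eraseLead_natDegree_lt_or_eraseLead_eq_zero p |>.resolve_right h)

/-- A function whose cube is a rational function in `x` has the valuation prescribed by the degree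
of that rational function. -/
theorem valuation_cube (hV : C.IsPlace V) (hx : C.x ∉ V) {T : C.K} {A B : ℂ[X]} (hA : A ≠ 0)
    (hB : B ≠ 0) (h : T ^ 3 * aeval C.x B = aeval C.x A) :
    V.valuation T ^ 3 * V.valuation C.x ^ B.natDegree = V.valuation C.x ^ A.natDegree := by
  rw [← valuation_aeval hV hx hA, ← valuation_aeval hV hx hB, ← map_pow, ← map_mul, h]

theorem valuation_cube_le_one_iff (hV : C.IsPlace V) (hx : C.x ∉ V) {T : C.K} {A B : ℂ[X]}
    (hA : A ≠ 0) (hB : B ≠ 0) (h : T ^ 3 * aeval C.x B = aeval C.x A) :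
    V.valuation T ≤ 1 ↔ A.natDegree ≤ B.natDegree := by
  have h1 := one_lt_valuation_x hx
  have h2 := valuation_cube hV hx hA hB h
  have h3 : 0 < V.valuation C.x ^ B.natDegree := pow_pos (zero_lt_one.trans h1) _
  rw [← pow_le_pow_iff_right₀ h1, ← h2, ← pow_le_one_iff_of_nonneg zero_le (three_ne_zero)]
  exact (mul_le_iff_le_one_left h3).symm

theorem valuation_cube_lt_one_iff (hV : C.IsPlace V) (hx : C.x ∉ V) {T : C.K} {A B : ℂ[X]}
    (hA : A ≠ 0) (hB : B ≠ 0) (h : T ^ 3 * aeval C.x B = aeval C.x A) :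
    V.valuation T < 1 ↔ A.natDegree < B.natDegree := by
  have h1 := one_lt_valuation_x hx
  have h2 := valuation_cube hV hx hA hB h
  have h3 : 0 < V.valuation C.x ^ B.natDegree := pow_pos (zero_lt_one.trans h1) _
  rw [← pow_lt_pow_iff_right₀ h1, ← h2, ← pow_lt_one_iff_of_nonneg zero_le (three_ne_zero)]
  exact (mul_lt_iff_lt_one_left h3).symm

theorem natDegree_add_eq_of_valuation_cube_eq (hV : C.IsPlace V) (hx : C.x ∉ V) {T T' : C.K}
    {A B A' B' : ℂ[X]} (hA : A ≠ 0) (hB : B ≠ 0) (h : T ^ 3 * aeval C.x B = aeval C.x A)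
    (hA' : A' ≠ 0) (hB' : B' ≠ 0) (h' : T' ^ 3 * aeval C.x B' = aeval C.x A')
    (hTT' : V.valuation T = V.valuation T') :
    A.natDegree + B'.natDegree = A'.natDegree + B.natDegree := by
  have h1 := one_lt_valuation_x hx
  apply pow_right_injective₀ (zero_lt_one.trans h1) h1.ne'
  simp only [pow_add]
  rw [← valuation_cube hV hx hA hB h, ← valuation_cube hV hx hA' hB' h', hTT']
  ac_rfl

/-- The valuation of a sum of two functions of different valuations. -/
theorem valuation_add_eq_max {R Γ : Type*} [Ring R]
    [LinearOrderedCommGroupWithZero Γ] (v : Valuation R Γ) {a b : R} (h : v a = v b → v b = 0) :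
    v (a + b) = max (v a) (v b) := by
  rcases lt_trichotomy (v a) (v b) with hab | hab | hab
  · rw [Valuation.map_add_eq_of_lt_right _ hab, max_eq_right hab.le]
  · have hb := h hab
    have ha := hab.trans hb
    refine le_antisymm (v.map_add _ _) ?_
    rw [ha, hb, max_self]
    exact zero_le
  · rw [Valuation.map_add_eq_of_lt_left _ hab, max_eq_left hab.le]

/-- The logarithmic derivative `x T' / T` of a function `T` whose cube is a rational function of `x`
has no pole at infinity. -/
theorem valuation_x_mul_ddx_le (hV : C.IsPlace V) (hx : C.x ∉ V) {T : C.K} {A B : ℂ[X]}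
    (hA : A ≠ 0) (hB : B ≠ 0) (h : T ^ 3 * aeval C.x B = aeval C.x A) :
    V.valuation (C.x * C.ddx T) ≤ V.valuation T := by
  have hA' := C.aeval_x_ne_zero hA
  have hB' := C.aeval_x_ne_zero hB
  have hx1 := one_lt_valuation_x hx
  have hT : T ≠ 0 := by
    rintro rfl
    rw [zero_pow three_ne_zero, zero_mul] at h
    exact hA' h.symm
  have hd := congrArg C.ddx h
  rw [Derivation.leibniz, Derivation.leibniz_pow, ddx_aeval, ddx_aeval] at hd
  simp only [smul_eq_mul, nsmul_eq_mul] at hd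
  push_cast at hd
  have hk : ∀ {p : ℂ[X]}, p ≠ 0 →
      V.valuation (C.x * aeval C.x (derivative p) / aeval C.x p) ≤ 1 := by
    intro p hp
    have hp0 : 0 < V.valuation (aeval C.x p) := by
      rw [zero_lt_iff, ne_eq, map_eq_zero]; exact C.aeval_x_ne_zero hp
    rw [map_div₀, div_le_one₀ hp0, valuation_aeval hV hx hp]
    rcases Nat.eq_zero_or_pos p.natDegree with h0 | h0
    · rw [eq_C_of_natDegree_eq_zero h0]; simp
    · rw [map_mul]
      calc _ ≤ V.valuation C.x * V.valuation C.x ^ (p.natDegree - 1) := by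
            gcongr
            exact valuation_aeval_le hV hx (natDegree_derivative_le p)
        _ = _ := by rw [← pow_succ', Nat.sub_add_cancel h0]
  have key : C.x * C.ddx T = T * (algebraMap ℂ C.K (1 / 3) *
      (C.x * aeval C.x (derivative A) / aeval C.x A -
        C.x * aeval C.x (derivative B) / aeval C.x B)) := by
    have h13 : algebraMap ℂ C.K (1 / 3) = 1 / 3 := by
      rw [map_div₀, map_one, map_ofNat]
    rw [h13, ← hd, ← h]
    field_simp
    ring
  rw [key, map_mul, map_mul]
  have : V.valuation (C.x * aeval C.x (derivative A) / aeval C.x A -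
        C.x * aeval C.x (derivative B) / aeval C.x B) ≤ 1 :=
    (Valuation.map_sub _ _ _).trans (max_le (hk hA) (hk hB))
  calc _ ≤ V.valuation T * (1 * 1) := by gcongr; exact valuation_algebraMap_le hV _
    _ = _ := by rw [mul_one, mul_one]

end Infinity

/-! ### The radicals `y` and `z` -/

theorem kr_monic : C.kr.Monic := monic_prod_of_monic _ _ fun _ _ => monic_X_sub_C _

theorem ks_monic : C.ks.Monic := monic_prod_of_monic _ _ fun _ _ => monic_X_sub_C _

theorem natDegree_kr : C.kr.natDegree = C.r := by
  rw [kr, natDegree_prod_of_monic _ _ fun _ _ => monic_X_sub_C _]; simp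

theorem natDegree_ks : C.ks.natDegree = C.s := by
  rw [ks, natDegree_prod_of_monic _ _ fun _ _ => monic_X_sub_C _]; simp

theorem kr_separable : C.kr.Separable :=
  separable_prod_X_sub_C_iff.mpr fun _ _ h => Sum.inr_injective (C.inj h)

theorem ks_separable : C.ks.Separable :=
  separable_prod_X_sub_C_iff.mpr fun _ _ h => Sum.inl_injective (C.inj h)

theorem isCoprime_kr_ks : IsCoprime C.kr C.ks :=
  IsCoprime.prod_left fun i _ => IsCoprime.prod_right fun j _ =>
    isCoprime_X_sub_C_of_isUnit_sub (sub_ne_zero.mpr fun h => by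
      have := C.inj h; simp at this).isUnit

/-- `u = ∛(a² b)` and `w = ∛(a b²)` for coprime squarefree monic polynomials `a` and `b` in `x` such
that the degree of `a² b` is prime to `3`. The pairs `(y, z)` and `(z, y)` are the ones of interest;
the notion makes their roles interchangeable. -/
structure IsRadicalPair (u w : C.K) (a b : ℂ[X]) : Prop where
  sq_left : u ^ 2 = w * aeval C.x a
  sq_right : w ^ 2 = u * aeval C.x b
  mul : u * w = aeval C.x a * aeval C.x b
  coprime : IsCoprime a b
  separable_left : a.Separable
  separable_right : b.Separable
  monic_left : a.Monic
  monic_right : b.Monic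
  not_dvd : ¬ 3 ∣ (a ^ 2 * b).natDegree

theorem natDegree_kr_sq_mul_ks : (C.kr ^ 2 * C.ks).natDegree = 2 * C.r + C.s := by
  rw [(C.kr_monic.pow 2).natDegree_mul C.ks_monic, C.kr_monic.natDegree_pow, natDegree_kr,
    natDegree_ks]

theorem natDegree_ks_sq_mul_kr : (C.ks ^ 2 * C.kr).natDegree = 2 * C.s + C.r := by
  rw [(C.ks_monic.pow 2).natDegree_mul C.kr_monic, C.ks_monic.natDegree_pow, natDegree_kr,
    natDegree_ks]

theorem isRadicalPair_y_z : C.IsRadicalPair C.y C.z C.kr C.ks where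
  sq_left := C.y_sq
  sq_right := C.z_sq
  mul := C.y_mul_z
  coprime := C.isCoprime_kr_ks
  separable_left := C.kr_separable
  separable_right := C.ks_separable
  monic_left := C.kr_monic
  monic_right := C.ks_monic
  not_dvd := by
    have := C.mod
    rw [natDegree_kr_sq_mul_ks]
    simp only [Nat.ModEq] at this
    omega

theorem isRadicalPair_z_y : C.IsRadicalPair C.z C.y C.ks C.kr where
  sq_left := C.z_sq
  sq_right := C.y_sq
  mul := by rw [mul_comm, C.y_mul_z, mul_comm]
  coprime := C.isCoprime_kr_ks.symm
  separable_left := C.ks_separable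
  separable_right := C.kr_separable
  monic_left := C.ks_monic
  monic_right := C.kr_monic
  not_dvd := by
    have := C.mod
    rw [natDegree_ks_sq_mul_kr]
    simp only [Nat.ModEq] at this
    omega

namespace IsRadicalPair

variable {C} {u w : C.K} {a b : ℂ[X]} (h : C.IsRadicalPair u w a b)
include h

theorem monic : (a ^ 2 * b).Monic := (h.monic_left.pow 2).mul h.monic_right

theorem pow_three : u ^ 3 = aeval C.x (a ^ 2 * b) := by
  rw [pow_succ', h.sq_left, map_mul, map_pow]
  linear_combination aeval C.x a * h.mul

theorem pow_three_right : w ^ 3 = aeval C.x (b ^ 2 * a) := by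
  rw [pow_succ', h.sq_right, map_mul, map_pow]
  linear_combination aeval C.x b * h.mul

theorem ne_zero : u ≠ 0 := by
  rintro rfl
  have := h.pow_three
  rw [zero_pow three_ne_zero] at this
  exact C.aeval_x_ne_zero h.monic.ne_zero this.symm

theorem ddx_eq : C.ddx u =
    u * aeval C.x (derivative (a ^ 2 * b)) / (3 * aeval C.x (a ^ 2 * b)) :=
  C.ddx_of_pow_three h.monic.ne_zero h.pow_three

end IsRadicalPair

/-! ### Regular differentials -/

section Regular

variable {C} {V : ValuationSubring C.K}

theorem isRegularAt_D {f : C.K} (hf : f ∈ V) :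
    C.IsRegularAt V (KaehlerDifferential.D ℂ C.K f) :=
  Submodule.subset_span ⟨f, hf, rfl⟩

theorem IsRegularAt.smul {ω : Ω[C.K⁄ℂ]} (hω : C.IsRegularAt V ω) {f : C.K} (hf : f ∈ V) :
    C.IsRegularAt V (f • ω) :=
  Submodule.smul_mem _ (⟨f, hf⟩ : V) hω

theorem IsRegularAt.add {ω η : Ω[C.K⁄ℂ]} (hω : C.IsRegularAt V ω) (hη : C.IsRegularAt V η) :
    C.IsRegularAt V (ω + η) :=
  Submodule.add_mem _ hω hη

theorem IsRegularAt.sub {ω η : Ω[C.K⁄ℂ]} (hω : C.IsRegularAt V ω) (hη : C.IsRegularAt V η) :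
    C.IsRegularAt V (ω - η) :=
  Submodule.sub_mem _ hω hη

theorem IsRegularAt.sum {ι : Type*} {s : Finset ι} {ω : ι → Ω[C.K⁄ℂ]}
    (hω : ∀ i ∈ s, C.IsRegularAt V (ω i)) : C.IsRegularAt V (∑ i ∈ s, ω i) :=
  Submodule.sum_mem _ hω

theorem aeval_mem (hV : C.IsPlace V) (hx : C.x ∈ V) (p : ℂ[X]) : aeval C.x p ∈ V := by
  rw [aeval_eq_sum_range]
  refine V.toSubring.sum_mem fun i _ => ?_
  rw [Algebra.smul_def]
  exact V.mul_mem _ _ (hV.1 _) (V.toSubring.pow_mem hx _)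

/-- A polynomial prime to one that vanishes at a point does not vanish there. -/
theorem inv_aeval_mem_of_isCoprime (hV : C.IsPlace V) (hx : C.x ∈ V) {p q : ℂ[X]}
    (hpq : IsCoprime p q) (hp : (aeval C.x p)⁻¹ ∉ V) : (aeval C.x q)⁻¹ ∈ V := by
  by_contra hq
  obtain ⟨α, β, hαβ⟩ := hpq
  have h1 := congrArg (aeval C.x) hαβ
  rw [map_add, map_mul, map_mul, map_one] at h1
  have hp0 : p ≠ 0 := by rintro rfl; simp at hp
  have hq0 : q ≠ 0 := by rintro rfl; simp at hq
  rw [← V.valuation_le_one_iff, not_le, map_inv₀] at hp hq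
  have hp' : V.valuation (aeval C.x p) < 1 :=
    (one_lt_inv₀ (zero_lt_iff.mpr (by simpa using C.aeval_x_ne_zero hp0))).mp hp
  have hq' : V.valuation (aeval C.x q) < 1 :=
    (one_lt_inv₀ (zero_lt_iff.mpr (by simpa using C.aeval_x_ne_zero hq0))).mp hq
  have hα := (V.valuation_le_one_iff _).mpr (aeval_mem hV hx α)
  have hβ := (V.valuation_le_one_iff _).mpr (aeval_mem hV hx β)
  have : V.valuation (1 : C.K) < 1 := by
    rw [← h1]
    refine Valuation.map_add_lt _ ?_ ?_
    · rw [map_mul]; exact mul_lt_one_of_nonneg_of_lt_one_right hα zero_le hp'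
    · rw [map_mul]; exact mul_lt_one_of_nonneg_of_lt_one_right hβ zero_le hq'
  rw [map_one] at this
  exact lt_irrefl _ this

theorem mem_of_pow_three_mem {f : C.K} (hf : f ^ 3 ∈ V) : f ∈ V := by
  rw [← V.valuation_le_one_iff, map_pow] at hf
  exact (V.valuation_le_one_iff _).mp ((pow_le_one_iff_of_nonneg zero_le three_ne_zero).mp hf)

theorem IsRadicalPair.mem {u w : C.K} {a b : ℂ[X]} (h : C.IsRadicalPair u w a b)
    (hV : C.IsPlace V) (hx : C.x ∈ V) : u ∈ V :=
  mem_of_pow_three_mem (h.pow_three ▸ aeval_mem hV hx _)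

/-- If `u = ∛M(x)`, then `dx = 3 u² du / M'(x)`. -/
theorem smul_dx_eq_of_pow_three {u : C.K} {M : ℂ[X]} (hM : derivative M ≠ 0)
    (hu : u ^ 3 = aeval C.x M) (f : C.K) :
    f • C.dx = (f * 3 * u ^ 2 * (aeval C.x (derivative M))⁻¹) • KaehlerDifferential.D ℂ C.K u := by
  have hM' := C.aeval_x_ne_zero hM
  have hd := congrArg C.ddx hu
  rw [Derivation.leibniz_pow, ddx_aeval] at hd
  simp only [smul_eq_mul, nsmul_eq_mul] at hd
  rw [D_eq_ddx, smul_smul]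
  congr 1
  field_simp
  rw [← hd]
  push_cast
  ring

/-- Where `b` vanishes, the derivative of `a² b` is invertible. -/
theorem inv_aeval_derivative_mem (hV : C.IsPlace V) (hx : C.x ∈ V) {a b : ℂ[X]}
    (hab : IsCoprime a b) (hb : b.Separable) (hbV : (aeval C.x b)⁻¹ ∉ V) :
    (aeval C.x (derivative (a ^ 2 * b)))⁻¹ ∈ V := by
  refine inv_aeval_mem_of_isCoprime hV hx ?_ hbV
  rw [derivative_mul]
  have : IsCoprime b (a ^ 2 * derivative b) := IsCoprime.mul_right hab.symm.pow_right hb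
  rw [mul_comm (derivative (a ^ 2)) b]
  exact this.mul_add_left_right _

/-- `dx / u` has no pole on the affine curve. -/
theorem IsRadicalPair.isRegularAt_of_mem {u w : C.K} {a b : ℂ[X]} (h : C.IsRadicalPair u w a b)
    (hV : C.IsPlace V) (hx : C.x ∈ V) : C.IsRegularAt V (u⁻¹ • C.dx) := by
  have hu := h.mem hV hx
  have h3 := (ofNat_mem V 3 : (3 : C.K) ∈ V)
  have hA := C.aeval_x_ne_zero h.monic_left.ne_zero
  have hB := C.aeval_x_ne_zero h.monic_right.ne_zero
  have hne : ∀ {p : ℂ[X]}, p.natDegree ≠ 0 → derivative p ≠ 0 := by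
    intro p hp h0
    exact hp (derivative_eq_zero.mp h0)
  by_cases hb : (aeval C.x b)⁻¹ ∈ V
  · by_cases ha : (aeval C.x a)⁻¹ ∈ V
    · refine (isRegularAt_D hx).smul ?_
      apply mem_of_pow_three_mem
      rw [inv_pow, h.pow_three, map_mul, map_pow, mul_inv, ← inv_pow]
      exact V.mul_mem _ _ (V.toSubring.pow_mem ha 2) hb
    · -- At a zero of `a` the function `w` is a local parameter.
      have hw : w ∈ V :=
        mem_of_pow_three_mem (h.pow_three_right ▸ aeval_mem hV hx _)
      have hd := inv_aeval_derivative_mem hV hx h.coprime.symm h.separable_left ha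
      rw [smul_dx_eq_of_pow_three (M := b ^ 2 * a) ?_ h.pow_three_right]
      · refine (isRegularAt_D hw).smul (V.mul_mem _ _ ?_ hd)
        have : u⁻¹ * 3 * w ^ 2 = 3 * aeval C.x b := by
          rw [h.sq_right]; have := h.ne_zero; field_simp
        rw [this]
        exact V.mul_mem _ _ h3 (aeval_mem hV hx _)
      · apply hne
        rw [(h.monic_right.pow 2).natDegree_mul h.monic_left, h.monic_right.natDegree_pow]
        intro h0
        have : a = 1 := h.monic_left.natDegree_eq_zero.mp (by omega)
        apply ha
        rw [this, map_one, inv_one]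
        exact V.one_mem
  · -- At a zero of `b` the function `u` is a local parameter.
    have hd := inv_aeval_derivative_mem hV hx h.coprime h.separable_right hb
    rw [smul_dx_eq_of_pow_three (M := a ^ 2 * b) ?_ h.pow_three]
    · refine (isRegularAt_D hu).smul (V.mul_mem _ _ ?_ hd)
      have : u⁻¹ * 3 * u ^ 2 = 3 * u := by
        have := h.ne_zero; field_simp
      rw [this]
      exact V.mul_mem _ _ h3 hu
    · apply hne
      rintro h0
      exact h.not_dvd (h0 ▸ dvd_zero 3)

end Regular

/-! ### Differentials at infinity -/

/-- Modulo the image of `Q ↦ 3 M Q' - Q M'` every polynomial has degree less than `deg M - 1`, if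
`deg M` is prime to `3`: the leading coefficient of the image of `x ^ k` is `3 k - deg M ≠ 0`. -/
theorem exists_degree_sub_lt {M : ℂ[X]} (hM : M.Monic) (h3 : ¬ 3 ∣ M.natDegree) (T : ℂ[X]) :
    ∃ Q : ℂ[X], (T - (3 * M * derivative Q - Q * derivative M)).degree <
      ((M.natDegree - 1 : ℕ) : WithBot ℕ) := by
  set e := M.natDegree with he
  have he1 : 1 ≤ e := by
    rcases Nat.eq_zero_or_pos e with h | h
    · exact absurd (h ▸ dvd_zero 3) h3
    · exact h
  suffices H : ∀ (n : ℕ) (T : ℂ[X]), T.degree < (n : WithBot ℕ) → ∃ Q : ℂ[X],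
      (T - (3 * M * derivative Q - Q * derivative M)).degree < ((e - 1 : ℕ) : WithBot ℕ) from
    H (T.natDegree + 1) T (lt_of_le_of_lt degree_le_natDegree
      (by exact_mod_cast Nat.lt_succ_self T.natDegree))
  intro n
  induction n with
  | zero =>
    intro T hT
    refine ⟨0, ?_⟩
    simp only [derivative_zero, mul_zero, zero_mul, sub_zero]
    exact hT.trans_le (by exact_mod_cast Nat.zero_le _)
  | succ n ih =>
    intro T hT
    by_cases hn : n + 1 ≤ e - 1
    · refine ⟨0, ?_⟩
      simp only [derivative_zero, mul_zero, zero_mul, sub_zero]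
      exact hT.trans_le (by exact_mod_cast hn)
    obtain ⟨k, rfl⟩ : ∃ k, n = k + (e - 1) := ⟨n - (e - 1), by omega⟩
    have hk : (3 * k - e : ℂ) ≠ 0 := by
      intro h
      have : ((3 * k : ℕ) : ℂ) = e := by push_cast; exact sub_eq_zero.mp h
      exact h3 ⟨k, (Nat.cast_injective this).symm⟩
    let c := T.coeff (k + (e - 1)) / (3 * k - e)
    obtain ⟨Q, hQ⟩ := ih (T - (3 * M * derivative (monomial k c) - monomial k c * derivative M)) (by
      rw [degree_lt_iff_coeff_zero]
      intro m hm
      have hTm : k + (e - 1) < m → T.coeff m = 0 := fun h =>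
        (degree_lt_iff_coeff_zero _ _).mp hT m (by omega)
      have h1 : (3 * M * derivative (monomial k c)).coeff m =
          3 * (M.coeff (m - k + 1) * (c * k)) := by
        have h3C : (3 : ℂ[X]) = Polynomial.C 3 := rfl
        rw [derivative_monomial, mul_assoc, h3C, coeff_C_mul, ← C_mul_X_pow_eq_monomial,
          ← mul_assoc, coeff_mul_X_pow', coeff_mul_C]
        rcases Nat.eq_zero_or_pos k with rfl | hk0
        · simp
        · rw [if_pos (by omega), show m - (k - 1) = m - k + 1 by omega]
      have h2 : (monomial k c * derivative M).coeff m =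
          c * (M.coeff (m - k + 1) * ((m - k : ℕ) + 1)) := by
        rw [← C_mul_X_pow_eq_monomial, mul_assoc, coeff_C_mul, coeff_X_pow_mul', if_pos (by omega),
          coeff_derivative]
      rw [coeff_sub, coeff_sub, h1, h2]
      rcases hm.eq_or_lt with rfl | hm
      · rw [show k + (e - 1) - k + 1 = e by omega, show k + (e - 1) - k = e - 1 by omega, he,
          hM.coeff_natDegree, ← he]
        push_cast [he1]
        have : c * (3 * k - e) = T.coeff (k + (e - 1)) := div_mul_cancel₀ _ hk
        linear_combination -this
      · rw [hTm hm, coeff_eq_zero_of_natDegree_lt (show M.natDegree < m - k + 1 by omega)]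
        simp)
    refine ⟨monomial k c + Q, ?_⟩
    convert hQ using 2
    rw [derivative_add]
    ring

section Infinity

variable {C} {V : ValuationSubring C.K} {u w : C.K} {a b : ℂ[X]}

theorem x_ne_zero : C.x ≠ 0 := by
  simpa using C.aeval_x_ne_zero X_ne_zero

/-- At a pole of `x`, the function `1 / x` is regular and `dx = - x² d(1 / x)`. -/
theorem isRegularAt_smul_dx (hx : C.x ∉ V) {f : C.K} (hf : C.x ^ 2 * f ∈ V) :
    C.IsRegularAt V (f • C.dx) := by
  have hx' : C.x⁻¹ ∈ V := (V.mem_or_inv_mem C.x).resolve_left hx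
  have h : f • C.dx = (-(C.x ^ 2 * f)) • KaehlerDifferential.D ℂ C.K C.x⁻¹ := by
    rw [D_eq_ddx, Derivation.leibniz_inv, ddx_x, smul_smul]
    congr 1
    have := C.x_ne_zero
    simp only [smul_eq_mul]
    field_simp
  rw [h]
  exact (isRegularAt_D hx').smul (V.neg_mem _ hf)

namespace IsRadicalPair

variable (h : C.IsRadicalPair u w a b)
include h

theorem ddx_div (Q : ℂ[X]) : C.ddx (aeval C.x Q / u) =
    aeval C.x (3 * (a ^ 2 * b) * derivative Q - Q * derivative (a ^ 2 * b)) /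
      (3 * aeval C.x (a ^ 2 * b)) * u⁻¹ := by
  have hM := C.aeval_x_ne_zero h.monic.ne_zero
  have hu := h.ne_zero
  rw [Derivation.leibniz_div, h.ddx_eq, ddx_aeval]
  generalize a ^ 2 * b = M at hM
  simp only [map_sub, map_mul, map_ofNat, smul_eq_mul] at hM ⊢
  field_simp

theorem cube_div (Q : ℂ[X]) :
    (aeval C.x Q / u) ^ 3 * aeval C.x (a ^ 2 * b) = aeval C.x (Q ^ 3) := by
  rw [div_pow, ← h.pow_three, map_pow, div_mul_cancel₀ _ (pow_ne_zero 3 h.ne_zero)]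

/-- At infinity `P(x) dx / u` has no residue: `P(x) dx / u - d(Q(x) / u)` is regular for some
polynomial `Q`. -/
theorem exists_isRegularAt_sub_D (hV : C.IsPlace V) (hx : C.x ∉ V) (P : ℂ[X]) :
    ∃ f : C.K, C.IsRegularAt V ((aeval C.x P * u⁻¹) • C.dx - KaehlerDifferential.D ℂ C.K f) := by
  have hM := C.aeval_x_ne_zero h.monic.ne_zero
  obtain ⟨Q, hQ⟩ := exists_degree_sub_lt h.monic h.not_dvd (3 * (a ^ 2 * b) * P)
  set T := 3 * (a ^ 2 * b) * P - (3 * (a ^ 2 * b) * derivative Q - Q * derivative (a ^ 2 * b))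
    with hT
  refine ⟨aeval C.x Q / u, ?_⟩
  have key : (aeval C.x P * u⁻¹) • C.dx - KaehlerDifferential.D ℂ C.K (aeval C.x Q / u) =
      (algebraMap ℂ C.K (1 / 3) * (aeval C.x T / aeval C.x (a ^ 2 * b)) * u⁻¹) • C.dx := by
    rw [D_eq_ddx, h.ddx_div, ← sub_smul]
    congr 1
    have h13 : algebraMap ℂ C.K (1 / 3) = 1 / 3 := by rw [map_div₀, map_one, map_ofNat]
    rw [h13, hT]
    generalize a ^ 2 * b = M at hM
    simp only [map_sub, map_mul, map_ofNat] at hM ⊢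
    field_simp
  rw [key]
  apply isRegularAt_smul_dx hx
  rw [← V.valuation_le_one_iff]
  have h1 : V.valuation u⁻¹ ≤ 1 := by
    have := h.cube_div 1
    rw [map_one, one_div, one_pow] at this
    exact (valuation_cube_le_one_iff hV hx one_ne_zero h.monic.ne_zero this).mpr (by simp)
  have hM0 : 0 < V.valuation (aeval C.x (a ^ 2 * b)) := zero_lt_iff.mpr (by simpa using hM)
  have h2 : V.valuation (C.x ^ 2 * (aeval C.x T / aeval C.x (a ^ 2 * b))) ≤ 1 := by
    rcases eq_or_ne T 0 with hT0 | hT0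
    · simp [hT0]
    · rw [mul_div_assoc', map_div₀, div_le_one₀ hM0, valuation_aeval hV hx h.monic.ne_zero,
        map_mul, map_pow, valuation_aeval hV hx hT0, ← pow_add]
      refine pow_le_pow_right₀ (one_lt_valuation_x hx).le ?_
      have := (natDegree_lt_iff_degree_lt hT0).mpr hQ
      omega
  calc _ = V.valuation (algebraMap ℂ C.K (1 / 3)) *
        V.valuation (C.x ^ 2 * (aeval C.x T / aeval C.x (a ^ 2 * b))) * V.valuation u⁻¹ := by
        rw [← map_mul, ← map_mul]; congr 1; ring
    _ ≤ 1 * 1 * 1 := by gcongr; exact valuation_algebraMap_le hV _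
    _ = 1 := by simp

/-- At infinity `x ^ m dx / u` is regular for small `m`: it is a regular function times
`d(x ^ (m + 1) / u)`. -/
theorem isRegularAt_pow (hV : C.IsPlace V) (hx : C.x ∉ V) {m : ℕ}
    (hm : 3 * m + 3 ≤ (a ^ 2 * b).natDegree) :
    C.IsRegularAt V ((C.x ^ m * u⁻¹) • C.dx) := by
  have hM := C.aeval_x_ne_zero h.monic.ne_zero
  have hM0 : a ^ 2 * b ≠ 0 := h.monic.ne_zero
  obtain ⟨M, hMdef⟩ : ∃ M, M = a ^ 2 * b := ⟨_, rfl⟩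
  rw [← hMdef] at hM hM0 hm
  let N : ℂ[X] := Polynomial.C (3 * (m + 1 : ℂ)) * M - X * derivative M
  have hcoeff : N.coeff M.natDegree ≠ 0 := by
    obtain ⟨d, hd⟩ : ∃ d, M.natDegree = d + 1 := ⟨M.natDegree - 1, by omega⟩
    have h1 : M.coeff (d + 1) = 1 := hd ▸ (hMdef ▸ h.monic : M.Monic).coeff_natDegree
    simp only [N]
    rw [hd, coeff_sub, coeff_C_mul, coeff_X_mul, coeff_derivative, h1, mul_one, one_mul]
    intro h0
    apply h.not_dvd
    rw [← hMdef, hd]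
    refine ⟨m + 1, ?_⟩
    have : ((d + 1 : ℕ) : ℂ) = ((3 * (m + 1) : ℕ) : ℂ) := by
      push_cast
      linear_combination -h0
    exact Nat.cast_injective this
  have hN0 : N ≠ 0 := by rintro h0; simp [h0] at hcoeff
  have hN := C.aeval_x_ne_zero hN0
  have hdeg : M.natDegree ≤ N.natDegree := le_natDegree_of_ne_zero hcoeff
  have hmem : aeval C.x ((X : ℂ[X]) ^ (m + 1)) / u ∈ V := by
    rw [← V.valuation_le_one_iff]
    refine (valuation_cube_le_one_iff hV hx (by simp) hM0 (hMdef ▸ h.cube_div _)).mpr ?_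
    rw [← pow_mul, natDegree_X_pow]
    omega
  have key : (C.x ^ m * u⁻¹) • C.dx = (3 * (aeval C.x M / aeval C.x N)) •
      KaehlerDifferential.D ℂ C.K (aeval C.x ((X : ℂ[X]) ^ (m + 1)) / u) := by
    rw [D_eq_ddx, h.ddx_div, smul_smul, ← hMdef]
    congr 1
    have hL : 3 * M * derivative ((X : ℂ[X]) ^ (m + 1)) - X ^ (m + 1) * derivative M =
        X ^ m * N := by
      simp only [N, derivative_X_pow]
      have : Polynomial.C (3 * (m + 1 : ℂ)) = 3 * (m + 1 : ℂ[X]) := by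
        simp only [map_mul, map_add, map_natCast, map_one, map_ofNat]
      rw [this, Nat.add_sub_cancel]
      push_cast
      simp only [map_add, map_natCast, map_one]
      ring
    rw [hL, map_mul, map_pow, aeval_X]
    field_simp
  rw [key]
  refine (isRegularAt_D hmem).smul (V.mul_mem _ _ (ofNat_mem V 3) ?_)
  rw [← V.valuation_le_one_iff, map_div₀, valuation_aeval hV hx hN0, valuation_aeval hV hx hM0]
  have h0 := zero_lt_one.trans (one_lt_valuation_x hx)
  rw [div_le_one₀ (pow_pos h0 _)]
  exact pow_le_pow_right₀ (one_lt_valuation_x hx).le hdeg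

end IsRadicalPair

end Infinity

/-! ### The pole at infinity -/

theorem exists_eq_sum_y_pow (f : C.K) : ∃ p q : ℕ → ℂ[X], (∀ i, q i ≠ 0) ∧
    f = ∑ i ∈ Finset.range 3, aeval C.x (p i) / aeval C.x (q i) * C.y ^ i := by
  obtain ⟨g, hg, hf⟩ := (AdjoinRoot.powerBasis' C.eqn_monic).exists_eq_aeval f
  rw [AdjoinRoot.powerBasis'_dim, eqn, natDegree_X_pow_sub_C] at hg
  refine ⟨fun i => (g.coeff i).num, fun i => (g.coeff i).denom,
    fun i => RatFunc.denom_ne_zero _, ?_⟩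
  rw [hf, aeval_eq_sum_range' hg]
  refine Finset.sum_congr rfl fun i _ => ?_
  rw [AdjoinRoot.powerBasis'_gen, Algebra.smul_def, aeval_x, aeval_x, ← map_div₀,
    RatFunc.num_div_denom]
  rfl

section Infinity

variable {C} {V : ValuationSubring C.K}

theorem cube_div_mul_y_pow {p q : ℂ[X]} (hq : q ≠ 0) (i : ℕ) :
    (aeval C.x p / aeval C.x q * C.y ^ i) ^ 3 * aeval C.x (q ^ 3) =
      aeval C.x (p ^ 3 * (C.kr ^ 2 * C.ks) ^ i) := by
  have hq' := C.aeval_x_ne_zero hq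
  rw [map_mul, map_pow _ (_ * _), ← C.isRadicalPair_y_z.pow_three, map_pow, map_pow]
  field_simp
  ring

theorem natDegree_pow_three_mul {p : ℂ[X]} (hp : p ≠ 0) (i : ℕ) :
    (p ^ 3 * (C.kr ^ 2 * C.ks) ^ i).natDegree = 3 * p.natDegree + i * (2 * C.r + C.s) := by
  have hM := C.isRadicalPair_y_z.monic
  rw [natDegree_mul (pow_ne_zero _ hp) (pow_ne_zero _ hM.ne_zero), natDegree_pow, natDegree_pow,
    natDegree_kr_sq_mul_ks]

/-- The derivation `x d/dx` maps functions regular at infinity to functions that vanish there. -/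
theorem valuation_x_mul_ddx_lt_one (hV : C.IsPlace V) (hx : C.x ∉ V) {f : C.K} (hf : f ∈ V) :
    V.valuation (C.x * C.ddx f) < 1 := by
  obtain ⟨p, q, hq, hsum⟩ := C.exists_eq_sum_y_pow f
  set T : ℕ → C.K := fun i => aeval C.x (p i) / aeval C.x (q i) * C.y ^ i with hT
  have hM := C.isRadicalPair_y_z.monic
  have hmod : ¬ 3 ∣ 2 * C.r + C.s := natDegree_kr_sq_mul_ks C ▸ C.isRadicalPair_y_z.not_dvd
  have hT0 : ∀ i, p i = 0 → T i = 0 := fun i h => by simp [hT, h]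
  have hA : ∀ i, p i ≠ 0 → p i ^ 3 * (C.kr ^ 2 * C.ks) ^ i ≠ 0 := fun i h =>
    mul_ne_zero (pow_ne_zero _ h) (pow_ne_zero _ hM.ne_zero)
  have hB : ∀ i, q i ^ 3 ≠ 0 := fun i => pow_ne_zero _ (hq i)
  have hcube : ∀ i, T i ^ 3 * aeval C.x (q i ^ 3) = aeval C.x (p i ^ 3 * (C.kr ^ 2 * C.ks) ^ i) :=
    fun i => cube_div_mul_y_pow (hq i) i
  -- The three terms have different valuations modulo the valuations of rational functions of `x`.
  have hne : ∀ i < 3, ∀ j < 3, i ≠ j → V.valuation (T i) = V.valuation (T j) →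
      V.valuation (T j) = 0 := by
    intro i hi j hj hij hv
    by_cases hpi : p i = 0
    · rw [← hv, hT0 i hpi, map_zero]
    by_cases hpj : p j = 0
    · rw [hT0 j hpj, map_zero]
    have := natDegree_add_eq_of_valuation_cube_eq hV hx (hA i hpi) (hB i) (hcube i) (hA j hpj)
      (hB j) (hcube j) hv
    rw [natDegree_pow_three_mul hpi, natDegree_pow_three_mul hpj, natDegree_pow,
      natDegree_pow] at this
    exfalso
    interval_cases i <;> interval_cases j <;> omega
  have hv : max (max (V.valuation (T 0)) (V.valuation (T 1))) (V.valuation (T 2)) ≤ 1 := by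
    rw [← valuation_add_eq_max _ (hne 0 (by norm_num) 1 (by norm_num) (by norm_num)),
      ← valuation_add_eq_max]
    · rw [Finset.sum_range_succ, Finset.sum_range_succ, Finset.sum_range_one] at hsum
      rw [← hsum]
      exact (V.valuation_le_one_iff _).mpr hf
    · rw [valuation_add_eq_max _ (hne 0 (by norm_num) 1 (by norm_num) (by norm_num))]
      intro h
      rcases max_choice (V.valuation (T 0)) (V.valuation (T 1)) with h' | h'
      · exact hne 0 (by norm_num) 2 (by norm_num) (by norm_num) (h'.symm.trans h)
      · exact hne 1 (by norm_num) 2 (by norm_num) (by norm_num) (h'.symm.trans h)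
  obtain ⟨hv01, hv2⟩ := max_le_iff.mp hv
  obtain ⟨hv0, hv1⟩ := max_le_iff.mp hv01
  have hlt : ∀ i, i = 1 ∨ i = 2 → V.valuation (T i) ≤ 1 → V.valuation (C.x * C.ddx (T i)) < 1 := by
    intro i hi hvi
    by_cases hpi : p i = 0
    · rw [hT0 i hpi]; simp
    refine (valuation_x_mul_ddx_le hV hx (hA i hpi) (hB i) (hcube i)).trans_lt ?_
    rw [valuation_cube_le_one_iff hV hx (hA i hpi) (hB i) (hcube i)] at hvi
    rw [valuation_cube_lt_one_iff hV hx (hA i hpi) (hB i) (hcube i)]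
    rw [natDegree_pow_three_mul hpi, natDegree_pow] at hvi ⊢
    rcases hi with rfl | rfl <;> omega
  -- The first term is a constant up to a function that vanishes at infinity.
  have h0 : V.valuation (C.x * C.ddx (T 0)) < 1 := by
    have hq0 := C.aeval_x_ne_zero (hq 0)
    have hdeg : (p 0).natDegree ≤ (q 0).natDegree := by
      by_cases hp0 : p 0 = 0
      · simp [hp0]
      rw [valuation_cube_le_one_iff hV hx (hA 0 hp0) (hB 0) (hcube 0),
        natDegree_pow_three_mul hp0, natDegree_pow] at hv0
      omega
    let c := (p 0).coeff (q 0).natDegree / (q 0).leadingCoeff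
    let t := p 0 - Polynomial.C c * q 0
    have htdeg : t.degree < (q 0).natDegree := by
      rw [degree_lt_iff_coeff_zero]
      intro m hm
      simp only [t, coeff_sub, coeff_C_mul]
      rcases hm.eq_or_lt with rfl | hm
      · rw [coeff_natDegree, div_mul_cancel₀ _ (leadingCoeff_ne_zero.mpr (hq 0)), sub_self]
      · rw [coeff_eq_zero_of_natDegree_lt hm, coeff_eq_zero_of_natDegree_lt (hdeg.trans_lt hm),
          mul_zero, sub_zero]
    have hsplit : T 0 = algebraMap ℂ C.K c + aeval C.x t / aeval C.x (q 0) * C.y ^ 0 := by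
      simp only [hT, t, map_sub, map_mul, aeval_C, pow_zero, mul_one]
      field_simp
      ring
    rw [hsplit, map_add, Derivation.map_algebraMap, zero_add]
    by_cases ht0 : t = 0
    · rw [ht0]; simp
    have hA' : t ^ 3 * (C.kr ^ 2 * C.ks) ^ 0 ≠ 0 := by simpa using ht0
    have hcube' := cube_div_mul_y_pow (C := C) (p := t) (hq 0) 0
    refine (valuation_x_mul_ddx_le hV hx hA' (hB 0) hcube').trans_lt ?_
    rw [valuation_cube_lt_one_iff hV hx hA' (hB 0) hcube', natDegree_pow_three_mul ht0,
      natDegree_pow]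
    have := (natDegree_lt_iff_degree_lt ht0).mpr htdeg
    omega
  rw [hsum, Finset.sum_range_succ, Finset.sum_range_succ, Finset.sum_range_one, map_add, map_add,
    mul_add, mul_add]
  exact Valuation.map_add_lt _ (Valuation.map_add_lt _ h0 (hlt 1 (Or.inl rfl) hv1))
    (hlt 2 (Or.inr rfl) hv2)

/-- The order of a differential that is regular at infinity is bounded below: `x ω / dx` vanishes
at infinity. -/
theorem IsRegularAt.valuation_x_mul_coeffDx_lt_one (hV : C.IsPlace V) (hx : C.x ∉ V)
    {ω : Ω[C.K⁄ℂ]} (hω : C.IsRegularAt V ω) : V.valuation (C.x * C.coeffDx ω) < 1 := by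
  induction hω using Submodule.span_induction with
  | mem η hη =>
    obtain ⟨f, hf, rfl⟩ := hη
    exact valuation_x_mul_ddx_lt_one hV hx hf
  | zero => simp
  | add η η' _ _ h h' => rw [map_add, mul_add]; exact Valuation.map_add_lt _ h h'
  | smul f η _ h =>
    have : C.coeffDx (f • η) = (f : C.K) * C.coeffDx η := map_smul C.coeffDx (f : C.K) η
    rw [this, mul_left_comm, map_mul]
    exact mul_lt_one_of_nonneg_of_lt_one_right ((V.valuation_le_one_iff _).mpr f.2) zero_le h

/-- At infinity `P(x) dx / u` has a pole if the degree of `P` is large. -/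
theorem IsRadicalPair.not_isRegularAt {u w : C.K} {a b : ℂ[X]} (h : C.IsRadicalPair u w a b)
    (hV : C.IsPlace V) (hx : C.x ∉ V) {P : ℂ[X]} (hP0 : P ≠ 0)
    (hP : (a ^ 2 * b).natDegree ≤ 3 * P.natDegree + 3) :
    ¬ C.IsRegularAt V ((aeval C.x P * u⁻¹) • C.dx) := by
  intro hreg
  have hlt := hreg.valuation_x_mul_coeffDx_lt_one hV hx
  rw [map_smul, coeffDx_dx, smul_eq_mul, mul_one] at hlt
  have hcube := h.cube_div (X * P)
  rw [map_mul, aeval_X, div_eq_mul_inv, mul_assoc] at hcube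
  rw [valuation_cube_lt_one_iff hV hx (pow_ne_zero _ (mul_ne_zero X_ne_zero hP0))
    h.monic.ne_zero hcube, natDegree_pow, natDegree_X_mul hP0] at hlt
  omega

end Infinity

/-! ### The polynomial `D` -/

section

variable {A : Type} [CommRing A] [Algebra ℂ A]

/-- `∂/∂q` of the divided difference `(p ^ n - q ^ n) / (p - q)`. -/
noncomputable def derivDividedDiffPow (p q : A) (n : ℕ) : A :=
  ∑ i ∈ Finset.range (n - 1), ((i : ℂ) + 1) • (p ^ (n - 2 - i) * q ^ i)

/-- `∂/∂q` of the divided difference `(k(p) - k(q)) / (p - q)` of a polynomial `k`. -/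
noncomputable def derivDividedDiff (k : ℂ[X]) (p q : A) : A :=
  ∑ n ∈ Finset.range (k.natDegree + 1), k.coeff n • derivDividedDiffPow p q n

theorem derivDividedDiffPow_succ (p q : A) (n : ℕ) :
    derivDividedDiffPow p q (n + 1) = p * derivDividedDiffPow p q n + n * q ^ (n - 1) := by
  rcases n with _ | n
  · simp [derivDividedDiffPow]
  · simp only [derivDividedDiffPow, Nat.add_sub_cancel]
    rw [Finset.sum_range_succ, Finset.mul_sum]
    congr 1
    · refine Finset.sum_congr rfl fun i hi => ?_
      have := Finset.mem_range.mp hi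
      rw [show n + 1 + 1 - 2 - i = (n + 1 - 2 - i) + 1 by omega, pow_succ, mul_smul_comm]
      congr 1
      ring
    · rw [show n + 1 + 1 - 2 - n = 0 by omega, Algebra.smul_def]
      simp

theorem sq_sub_mul_derivDividedDiffPow (p q : A) (n : ℕ) :
    (p - q) ^ 2 * derivDividedDiffPow p q n = p ^ n - q ^ n - (p - q) * (n * q ^ (n - 1)) := by
  induction n with
  | zero => simp [derivDividedDiffPow]
  | succ n ih =>
    rw [derivDividedDiffPow_succ, mul_add, mul_left_comm, ih]
    rcases n with _ | n
    · simp
    · simp only [Nat.add_sub_cancel]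
      push_cast
      ring

theorem sq_sub_mul_derivDividedDiff (k : ℂ[X]) (p q : A) :
    (p - q) ^ 2 * derivDividedDiff k p q =
      aeval p k - aeval q k - (p - q) * aeval q (derivative k) := by
  have hd : aeval q (derivative k) =
      ∑ n ∈ Finset.range (k.natDegree + 1), k.coeff n • ((n : A) * q ^ (n - 1)) := by
    conv_lhs => rw [k.as_sum_range]
    simp only [map_sum, derivative_monomial, aeval_monomial, map_mul, map_natCast,
      Algebra.smul_def, mul_assoc]
  rw [hd, aeval_eq_sum_range, aeval_eq_sum_range, derivDividedDiff, Finset.mul_sum, Finset.mul_sum,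
    ← Finset.sum_sub_distrib, ← Finset.sum_sub_distrib]
  refine Finset.sum_congr rfl fun n _ => ?_
  rw [mul_smul_comm, sq_sub_mul_derivDividedDiffPow, mul_smul_comm, smul_sub, smul_sub]

/-- The sum over the coefficients of `k` in descending order, as in the definition of `D`. -/
theorem sum_eq_derivDividedDiff {k : ℂ[X]} {N : ℕ} (hk : k.natDegree = N) (p q : A) :
    ∑ j ∈ Finset.range (N - 1), ∑ i ∈ Finset.range (N - j - 1),
      (((i : ℂ) + 1) * k.coeff (N - j)) • (p ^ (N - j - i - 2) * q ^ i) =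
      derivDividedDiff k p q := by
  have hinner : ∀ j, ∑ i ∈ Finset.range (N - j - 1),
      (((i : ℂ) + 1) * k.coeff (N - j)) • (p ^ (N - j - i - 2) * q ^ i) =
      k.coeff (N - j) • derivDividedDiffPow p q (N - j) := by
    intro j
    rw [derivDividedDiffPow, Finset.smul_sum]
    refine Finset.sum_congr rfl fun i _ => ?_
    rw [smul_smul, mul_comm, Nat.sub_right_comm (N - j) i 2]
  simp only [hinner]
  rw [derivDividedDiff, hk]
  conv_rhs => rw [← Finset.sum_range_reflect]
  simp only [Nat.add_sub_cancel]
  refine Finset.sum_subset (Finset.range_mono (by omega)) fun j hj hj' => ?_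
  rw [Finset.mem_range] at hj hj'
  have : N - j - 1 = 0 := by omega
  rw [derivDividedDiffPow, this, Finset.range_zero, Finset.sum_empty, smul_zero]

theorem natDegree_ks_mul_kr : (C.ks * C.kr).natDegree = C.s + C.r := by
  rw [C.ks_monic.natDegree_mul C.kr_monic, natDegree_ks, natDegree_kr]

theorem Dplus_eq (p q : A) : C.Dplus p q =
    derivDividedDiff (C.ks * C.kr) p q + aeval q C.kr * derivDividedDiff C.ks p q := by
  rw [Dplus, ← sum_eq_derivDividedDiff C.natDegree_ks_mul_kr,
    ← sum_eq_derivDividedDiff C.natDegree_ks, aeval_eq_sum_range, natDegree_kr]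
  congr 1
  · simp only [lamsr, add_comm C.r C.s]
  · rw [Finset.mul_sum]
    refine Finset.sum_congr rfl fun j _ => ?_
    rw [Finset.mul_sum]
    refine Finset.sum_congr rfl fun i _ => ?_
    rw [Finset.sum_mul]
    refine Finset.sum_congr rfl fun k hk => ?_
    rw [lamr, Nat.sub_sub_self (Nat.lt_succ_iff.mp (Finset.mem_range.mp hk)), lams,
      smul_mul_smul_comm, mul_comm (C.kr.coeff k), pow_add]
    congr 1
    ring

theorem Dminus_eq (p q : A) : C.Dminus p q =
    derivDividedDiff (C.ks * C.kr) q p + aeval p C.ks * derivDividedDiff C.kr q p := by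
  rw [Dminus, ← sum_eq_derivDividedDiff C.natDegree_ks_mul_kr,
    ← sum_eq_derivDividedDiff C.natDegree_kr, aeval_eq_sum_range, natDegree_ks]
  congr 1
  · simp only [lamsr, add_comm C.r C.s]
  · rw [Finset.mul_sum]
    refine Finset.sum_congr rfl fun j _ => ?_
    rw [Finset.mul_sum]
    refine Finset.sum_congr rfl fun i _ => ?_
    rw [Finset.sum_mul]
    refine Finset.sum_congr rfl fun k hk => ?_
    rw [lams, Nat.sub_sub_self (Nat.lt_succ_iff.mp (Finset.mem_range.mp hk)), lamr,
      smul_mul_smul_comm, mul_comm (C.ks.coeff k), pow_add]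
    congr 1
    ring

/-- The closed form of `D(P, Q)`. -/
theorem sq_sub_mul_Drs (p q : A) : (p - q) ^ 2 * C.Drs p q =
    3 * (aeval q C.ks * aeval q C.kr - aeval p C.ks * aeval p C.kr) + (p - q) *
      (aeval p (derivative (C.ks * C.kr)) + aeval q (derivative (C.ks * C.kr)) +
        aeval p C.ks * aeval p (derivative C.kr) + aeval q C.kr * aeval q (derivative C.ks)) := by
  have h1 := sq_sub_mul_derivDividedDiff (C.ks * C.kr) p q
  have h2 := sq_sub_mul_derivDividedDiff (C.ks * C.kr) q p
  have h3 := sq_sub_mul_derivDividedDiff C.ks p q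
  have h4 := sq_sub_mul_derivDividedDiff C.kr q p
  rw [map_mul, map_mul] at h1 h2
  rw [Drs, Dplus_eq, Dminus_eq]
  linear_combination h2 + aeval p C.ks * h4 - h1 - aeval q C.kr * h3

end

/-! ### The coefficients of `D` -/

/-- The coefficient of `x_P ^ m x_Q ^ n` in `D(P, Q)`. -/
noncomputable def drsCoeff (m n : ℕ) : ℂ :=
  ((C.Drs (Polynomial.C X) X : ℂ[X][X]).coeff n).coeff m

theorem coeff_coeff_derivDividedDiff (k : ℂ[X]) (m n : ℕ) :
    ((derivDividedDiff k (Polynomial.C X) X : ℂ[X][X]).coeff n).coeff m =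
      (n + 1) * k.coeff (m + n + 2) := by
  have h : ∀ N, ((derivDividedDiffPow (Polynomial.C X) X N : ℂ[X][X]).coeff n).coeff m =
      if m + n + 2 = N then (n + 1 : ℂ) else 0 := by
    intro N
    simp only [derivDividedDiffPow, finsetSum_coeff, coeff_smul, ← C_pow, coeff_C_mul_X_pow,
      smul_ite, smul_zero, Finset.sum_ite_eq, Finset.mem_range]
    split_ifs with h1 h2 h2
    · rw [coeff_smul, coeff_X_pow, if_pos (by omega), smul_eq_mul, mul_one]
    · rw [coeff_smul, coeff_X_pow, if_neg (by omega), smul_zero]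
    · omega
    · rfl
  simp only [derivDividedDiff, finsetSum_coeff, coeff_smul, h, smul_eq_mul, mul_ite, mul_zero,
    Finset.sum_ite_eq, Finset.mem_range]
  split_ifs with h1
  · ring
  · rw [coeff_eq_zero_of_natDegree_lt (by omega), mul_zero]

theorem coeff_coeff_derivDividedDiff_swap (k : ℂ[X]) (m n : ℕ) :
    ((derivDividedDiff k X (Polynomial.C X) : ℂ[X][X]).coeff n).coeff m =
      (m + 1) * k.coeff (m + n + 2) := by
  have h : ∀ N, ((derivDividedDiffPow X (Polynomial.C X) N : ℂ[X][X]).coeff n).coeff m =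
      if m + n + 2 = N then (m + 1 : ℂ) else 0 := by
    intro N
    simp only [derivDividedDiffPow, finsetSum_coeff, coeff_smul, ← C_pow, mul_comm (X ^ _),
      coeff_C_mul_X_pow]
    have hterm : ∀ i ∈ Finset.range (N - 1),
        (i + 1 : ℂ) • (if n = N - 2 - i then (X : ℂ[X]) ^ i else 0).coeff m =
          if m = i then (if m + n + 2 = N then (m + 1 : ℂ) else 0) else 0 := by
      intro i hi
      have := Finset.mem_range.mp hi
      rw [apply_ite (fun t : ℂ[X] => t.coeff m), coeff_X_pow, coeff_zero]
      split_ifs with h1 h2 h3 h3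
      · rw [h2, smul_eq_mul, mul_one]
      · omega
      · exact smul_zero _
      · omega
      · exact smul_zero _
      · exact smul_zero _
    rw [Finset.sum_congr rfl hterm, Finset.sum_ite_eq]
    split_ifs with h1 h2 h2
    · rfl
    · rfl
    · rw [Finset.mem_range] at h1
      omega
    · rfl
  simp only [derivDividedDiff, finsetSum_coeff, coeff_smul, h, smul_eq_mul, mul_ite, mul_zero,
    Finset.sum_ite_eq, Finset.mem_range]
  split_ifs with h1
  · ring
  · rw [coeff_eq_zero_of_natDegree_lt (by omega), mul_zero]

theorem drsCoeff_eq (m n : ℕ) : C.drsCoeff m n =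
    (m + 1) * (C.ks * C.kr).coeff (m + n + 2) +
      ∑ ij ∈ Finset.HasAntidiagonal.antidiagonal m,
        C.ks.coeff ij.1 * ((ij.2 + 1) * C.kr.coeff (ij.2 + n + 2)) -
    ((n + 1) * (C.ks * C.kr).coeff (m + n + 2) +
      ∑ ij ∈ Finset.HasAntidiagonal.antidiagonal n,
        C.kr.coeff ij.1 * ((ij.2 + 1) * C.ks.coeff (m + ij.2 + 2))) := by
  have h1 : aeval (Polynomial.C X : ℂ[X][X]) C.ks = Polynomial.C C.ks := by
    change aeval (CAlgHom (R := ℂ) (X : ℂ[X])) C.ks = CAlgHom (R := ℂ) C.ks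
    rw [aeval_algHom_apply, aeval_X_left_apply]
  have h2 : aeval (X : ℂ[X][X]) C.kr = C.kr.map Polynomial.C := by
    rw [aeval_def]
    rfl
  rw [drsCoeff, Drs, Dplus_eq, Dminus_eq, h1, h2]
  simp only [coeff_sub, coeff_add, coeff_coeff_derivDividedDiff, coeff_coeff_derivDividedDiff_swap,
    coeff_C_mul]
  rw [coeff_mul C.ks ((derivDividedDiff C.kr X (Polynomial.C X) : ℂ[X][X]).coeff n),
    coeff_mul (C.kr.map _), finsetSum_coeff]
  simp only [coeff_coeff_derivDividedDiff_swap, coeff_map, coeff_C_mul,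
    coeff_coeff_derivDividedDiff]

theorem sum_antidiagonal_eq_zero {k l : ℂ[X]} {m n : ℕ}
    (h : k.natDegree + l.natDegree < m + n + 2) :
    ∑ ij ∈ Finset.HasAntidiagonal.antidiagonal m,
      k.coeff ij.1 * ((ij.2 + 1) * l.coeff (ij.2 + n + 2)) = 0 := by
  refine Finset.sum_eq_zero fun ij hij => ?_
  have := Finset.HasAntidiagonal.mem_antidiagonal.mp hij
  rcases lt_or_ge k.natDegree ij.1 with h1 | h1
  · rw [coeff_eq_zero_of_natDegree_lt h1, zero_mul]
  · rw [coeff_eq_zero_of_natDegree_lt (show l.natDegree < ij.2 + n + 2 by omega), mul_zero,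
      mul_zero]

theorem sum_antidiagonal_eq_of_monic {k l : ℂ[X]} (hk : k.Monic) (hl : l.Monic) {m n : ℕ}
    (h : m + n + 2 = k.natDegree + l.natDegree) :
    ∑ ij ∈ Finset.HasAntidiagonal.antidiagonal m,
      k.coeff ij.1 * ((ij.2 + 1) * l.coeff (ij.2 + n + 2)) =
      if k.natDegree ≤ m then (m - k.natDegree + 1 : ℂ) else 0 := by
  have hz : ∀ ij ∈ Finset.HasAntidiagonal.antidiagonal m, ij.1 ≠ k.natDegree →
      k.coeff ij.1 * ((ij.2 + 1) * l.coeff (ij.2 + n + 2)) = 0 := by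
    intro ij hij hne
    have := Finset.HasAntidiagonal.mem_antidiagonal.mp hij
    rcases lt_or_gt_of_ne hne with h1 | h1
    · rw [coeff_eq_zero_of_natDegree_lt (show l.natDegree < ij.2 + n + 2 by omega), mul_zero,
        mul_zero]
    · rw [coeff_eq_zero_of_natDegree_lt h1, zero_mul]
  split_ifs with hm
  · rw [Finset.sum_eq_single (k.natDegree, m - k.natDegree)]
    · rw [show m - k.natDegree + n + 2 = l.natDegree by omega, hk.coeff_natDegree,
        hl.coeff_natDegree, Nat.cast_sub hm]
      ring
    · rintro ⟨i, j⟩ hij hne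
      refine hz _ hij fun hi => hne ?_
      have := Finset.HasAntidiagonal.mem_antidiagonal.mp hij
      simp only at hi this
      rw [Prod.mk.injEq]
      omega
    · intro h'
      exact absurd (Finset.HasAntidiagonal.mem_antidiagonal.mpr (Nat.add_sub_cancel' hm)) h'
  · refine Finset.sum_eq_zero fun ij hij => hz _ hij ?_
    have := Finset.HasAntidiagonal.mem_antidiagonal.mp hij
    omega

theorem drsCoeff_eq_zero {m n : ℕ} (h : C.s + C.r < m + n + 2) : C.drsCoeff m n = 0 := by
  have h1 := sum_antidiagonal_eq_zero (k := C.ks) (l := C.kr) (m := m) (n := n)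
    (by rwa [natDegree_ks, natDegree_kr])
  have h2 := sum_antidiagonal_eq_zero (k := C.kr) (l := C.ks) (m := n) (n := m)
    (by rw [natDegree_ks, natDegree_kr]; omega)
  simp only [add_comm _ m] at h2
  rw [drsCoeff_eq, h1, h2, coeff_eq_zero_of_natDegree_lt (by rwa [natDegree_ks_mul_kr])]
  ring

/-- The coefficients of the monomials of top degree in `D`. -/
theorem drsCoeff_top {m n : ℕ} (h : m + n + 2 = C.s + C.r) :
    C.drsCoeff m n = (C.s + 2 * C.r : ℂ) - 3 * (n + 1) := by
  have h1 := sum_antidiagonal_eq_of_monic C.ks_monic C.kr_monic (m := m) (n := n)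
    (by rwa [natDegree_ks, natDegree_kr])
  have h2 := sum_antidiagonal_eq_of_monic C.kr_monic C.ks_monic (m := n) (n := m)
    (by rw [natDegree_ks, natDegree_kr]; omega)
  simp only [add_comm _ m] at h2
  have hK : (C.ks * C.kr).coeff (m + n + 2) = 1 := by
    rw [h, ← natDegree_ks_mul_kr]
    exact (C.ks_monic.mul C.kr_monic).coeff_natDegree
  have hc : (m : ℂ) = C.s + C.r - n - 2 := by
    have := congrArg (Nat.cast (R := ℂ)) h
    push_cast at this
    linear_combination this
  rw [drsCoeff_eq, h1, h2, hK, natDegree_ks, natDegree_kr]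
  rcases lt_trichotomy (n + 1) C.r with hn | hn | hn
  · rw [if_pos (by omega), if_neg (by omega), hc]
    ring
  · have : (C.r : ℂ) = n + 1 := by rw [← hn]; push_cast; rfl
    rw [if_neg (by omega), if_neg (by omega), hc, this]
    ring
  · rw [if_neg (by omega), if_pos (by omega), hc]
    ring

theorem drsCoeff_top_ne_zero {m n : ℕ} (h : m + n + 2 = C.s + C.r) : C.drsCoeff m n ≠ 0 := by
  rw [drsCoeff_top C h]
  intro h0
  have : ((C.s + 2 * C.r : ℕ) : ℂ) = ((3 * (n + 1) : ℕ) : ℂ) := by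
    push_cast
    linear_combination h0
  have := Nat.cast_injective this
  have h3 := C.mod
  simp only [Nat.ModEq] at h3
  omega

theorem map_Drs {A B : Type} [CommRing A] [Algebra ℂ A] [CommRing B] [Algebra ℂ B] (φ : A →ₐ[ℂ] B)
    (p q : A) : φ (C.Drs p q) = C.Drs (φ p) (φ q) := by
  simp only [Drs, Dplus, Dminus, map_sub, map_add, map_sum, map_smul, map_mul, map_pow]

/-- `D` as the sum of its monomials. -/
theorem Drs_eq_sum {A : Type} [CommRing A] [Algebra ℂ A] (p q : A) : C.Drs p q =
    ∑ n ∈ Finset.range (C.s + C.r), ∑ m ∈ Finset.range (C.s + C.r),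
      C.drsCoeff m n • (p ^ m * q ^ n) := by
  let F : ℂ[X][X] := C.Drs (Polynomial.C X) X
  have hF : F = ∑ n ∈ Finset.range (C.s + C.r), ∑ m ∈ Finset.range (C.s + C.r),
      C.drsCoeff m n • ((Polynomial.C X) ^ m * X ^ n) := by
    ext n m
    change C.drsCoeff m n = _
    have h : ∀ n' m', (C.drsCoeff m' n' • if n = n' then (X : ℂ[X]) ^ m' else 0).coeff m =
        if m = m' then (if n = n' then C.drsCoeff m' n' else 0) else 0 := by
      intro n' m'
      rw [coeff_smul, apply_ite (fun t : ℂ[X] => t.coeff m), coeff_X_pow, coeff_zero]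
      split_ifs <;> simp
    simp only [finsetSum_coeff, coeff_smul (C.drsCoeff _ _) (_ : ℂ[X][X]), ← C_pow,
      coeff_C_mul_X_pow, h, Finset.sum_ite_eq, Finset.mem_range]
    by_cases hm : m < C.s + C.r
    · simp only [hm, if_true, Finset.sum_ite_eq, Finset.mem_range]
      split_ifs with hn
      · rfl
      · exact C.drsCoeff_eq_zero (by omega)
    · simp only [hm, if_false, Finset.sum_const_zero]
      exact C.drsCoeff_eq_zero (by omega)
  let φ : ℂ[X][X] →ₐ[ℂ] A := eval₂AlgHom (aeval p) q fun _ => Commute.all _ _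
  have hp : φ (Polynomial.C X) = p := by simp [φ]
  have hq : φ X = q := by simp [φ]
  have := congrArg φ hF
  simp only [F, map_Drs, map_sum, map_smul, map_mul, map_pow, hp, hq] at this
  exact this

/-! ### The explicit representatives -/

theorem gr_add_gs : C.gr + C.gs + 1 = C.s + C.r := by
  have h1 := C.lt
  have h2 := C.card_idx
  rw [Fintype.card_sum, Fintype.card_fin, Fintype.card_fin, g] at h2
  omega

theorem phiMono_inl (a : Fin C.gr) :
    C.phiMono (.inl a) = Finsupp.single 0 (a : ℕ) + Finsupp.single 1 1 := rfl

theorem phiMono_inr (a : Fin C.gs) :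
    C.phiMono (.inr a) = Finsupp.single 0 (a : ℕ) + Finsupp.single 2 1 := rfl

theorem single_add_single_inj {i : Fin 3} (m n : ℕ) :
    (Finsupp.single 0 m + Finsupp.single i 1 : Fin 3 →₀ ℕ) =
      Finsupp.single 0 n + Finsupp.single i 1 ↔ m = n := by
  rw [add_left_inj]
  exact (Finsupp.single_injective _).eq_iff

theorem single_add_single_one_ne_two (m n : ℕ) :
    (Finsupp.single 0 m + Finsupp.single 1 1 : Fin 3 →₀ ℕ) ≠
      Finsupp.single 0 n + Finsupp.single 2 1 := by
  intro h
  have := DFunLike.congr_fun h 1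
  simp at this

theorem monomial_single_add_single {R : Type} [CommRing R] (i : Fin 3) (n : ℕ) (c : R) :
    MvPolynomial.monomial (Finsupp.single 0 n + Finsupp.single i 1) c =
      MvPolynomial.C c * (MvPolynomial.X 0 ^ n * MvPolynomial.X i) := by
  rw [MvPolynomial.monomial_single_add, ← MvPolynomial.C_mul_X_eq_monomial, mul_left_comm]

/-- A monomial in the coordinates of `P` and `Q`. -/
theorem monomial_monomial (i j : Fin 3) (m n : ℕ) (d : ℂ) :
    MvPolynomial.monomial (Finsupp.single 0 n + Finsupp.single i 1 : Fin 3 →₀ ℕ)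
        (MvPolynomial.monomial (Finsupp.single 0 m + Finsupp.single j 1 : Fin 3 →₀ ℕ) d) =
      MvPolynomial.C (MvPolynomial.X j) * MvPolynomial.X i *
        (d • (MvPolynomial.C (MvPolynomial.X 0) ^ m * MvPolynomial.X 0 ^ n)) := by
  have hsmul : ∀ F : MvPolynomial (Fin 3) (MvPolynomial (Fin 3) ℂ),
      d • F = MvPolynomial.C (MvPolynomial.C d) * F := fun F => Algebra.smul_def d F
  rw [monomial_single_add_single, monomial_single_add_single, hsmul, map_mul, map_mul, map_pow]
  generalize (MvPolynomial.C (MvPolynomial.C d) :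
    MvPolynomial (Fin 3) (MvPolynomial (Fin 3) ℂ)) = t₁
  generalize (MvPolynomial.C (MvPolynomial.X 0) :
    MvPolynomial (Fin 3) (MvPolynomial (Fin 3) ℂ)) = t₂
  generalize (MvPolynomial.C (MvPolynomial.X j) :
    MvPolynomial (Fin 3) (MvPolynomial (Fin 3) ℂ)) = t₃
  ring

theorem monomial_monomial_comm (i j : Fin 3) (m n : ℕ) (d : ℂ) :
    MvPolynomial.monomial (Finsupp.single 0 n + Finsupp.single i 1 : Fin 3 →₀ ℕ)
        (MvPolynomial.monomial (Finsupp.single 0 m + Finsupp.single j 1 : Fin 3 →₀ ℕ) d) =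
      MvPolynomial.X i * MvPolynomial.C (MvPolynomial.X j) *
        (d • (MvPolynomial.X 0 ^ n * MvPolynomial.C (MvPolynomial.X 0) ^ m)) := by
  rw [monomial_monomial, mul_comm (MvPolynomial.X i), mul_comm (MvPolynomial.X 0 ^ n)]

theorem Dhat_eq_sum : C.Dhat =
    ∑ n ∈ Finset.range (C.s + C.r), ∑ m ∈ Finset.range (C.s + C.r),
      MvPolynomial.monomial (Finsupp.single 0 n + Finsupp.single 2 1)
        (MvPolynomial.monomial (Finsupp.single 0 m + Finsupp.single 1 1) (C.drsCoeff m n)) -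
    ∑ n ∈ Finset.range (C.s + C.r), ∑ m ∈ Finset.range (C.s + C.r),
      MvPolynomial.monomial (Finsupp.single 0 m + Finsupp.single 1 1)
        (MvPolynomial.monomial (Finsupp.single 0 n + Finsupp.single 2 1) (C.drsCoeff m n)) := by
  simp only [monomial_monomial 2 1, monomial_monomial_comm 1 2, ← Finset.mul_sum, Dhat, Drs_eq_sum]

theorem piHat_inl (a : Fin C.gr) : C.piHat (.inl a) =
    -∑ n ∈ Finset.range (C.s + C.r),
      MvPolynomial.monomial (Finsupp.single 0 n + Finsupp.single 2 1) (C.drsCoeff a n) := by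
  have ha : (a : ℕ) < C.s + C.r := by have := a.2; have := C.gr_add_gs; omega
  simp only [piHat, Dhat_eq_sum, phiMono_inl, MvPolynomial.coeff_sub, MvPolynomial.coeff_sum,
    MvPolynomial.coeff_monomial, single_add_single_inj, (single_add_single_one_ne_two _ _).symm,
    if_false, Finset.sum_const_zero, zero_sub, Finset.sum_ite_eq', Finset.mem_range, ha, if_true]

theorem piHat_inr (a : Fin C.gs) : C.piHat (.inr a) =
    ∑ m ∈ Finset.range (C.s + C.r),
      MvPolynomial.monomial (Finsupp.single 0 m + Finsupp.single 1 1) (C.drsCoeff m a) := by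
  have ha : (a : ℕ) < C.s + C.r := by have := a.2; have := C.gr_add_gs; omega
  simp only [piHat, Dhat_eq_sum, phiMono_inr, MvPolynomial.coeff_sub, MvPolynomial.coeff_sum,
    MvPolynomial.coeff_monomial, single_add_single_inj, single_add_single_one_ne_two,
    if_false, Finset.sum_const_zero, sub_zero]
  rw [Finset.sum_comm]
  simp only [Finset.sum_ite_eq', Finset.mem_range, ha, if_true]

theorem piHat₂_inl_inl (a b : Fin C.gr) : C.piHat₂ (.inl a) (.inl b) = 0 := by
  simp only [piHat₂, piHat_inl, phiMono_inl, MvPolynomial.coeff_neg, MvPolynomial.coeff_sum,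
    MvPolynomial.coeff_monomial, (single_add_single_one_ne_two _ _).symm, if_false,
    Finset.sum_const_zero, neg_zero]

theorem piHat₂_inl_inr (a : Fin C.gr) (b : Fin C.gs) :
    C.piHat₂ (.inl a) (.inr b) = -C.drsCoeff a b := by
  have hb : (b : ℕ) < C.s + C.r := by have := b.2; have := C.gr_add_gs; omega
  simp only [piHat₂, piHat_inl, phiMono_inr, MvPolynomial.coeff_neg, MvPolynomial.coeff_sum,
    MvPolynomial.coeff_monomial, single_add_single_inj, Finset.sum_ite_eq', Finset.mem_range, hb,
    if_true]

theorem piHat₂_inr_inl (a : Fin C.gs) (b : Fin C.gr) :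
    C.piHat₂ (.inr a) (.inl b) = C.drsCoeff b a := by
  have hb : (b : ℕ) < C.s + C.r := by have := b.2; have := C.gr_add_gs; omega
  simp only [piHat₂, piHat_inr, phiMono_inl, MvPolynomial.coeff_sum,
    MvPolynomial.coeff_monomial, single_add_single_inj, Finset.sum_ite_eq', Finset.mem_range, hb,
    if_true]

theorem piHat₂_inr_inr (a b : Fin C.gs) : C.piHat₂ (.inr a) (.inr b) = 0 := by
  simp only [piHat₂, piHat_inr, phiMono_inr, MvPolynomial.coeff_sum,
    MvPolynomial.coeff_monomial, single_add_single_one_ne_two, if_false,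
    Finset.sum_const_zero]

theorem toFun_monomial (i : Fin 3) (n : ℕ) (c : ℂ) :
    C.toFun (MvPolynomial.monomial (Finsupp.single 0 n + Finsupp.single i 1) c) =
      c • (C.x ^ n * ![C.x, C.y, C.z] i) := by
  rw [toFun, MvPolynomial.aeval_monomial, Finsupp.prod_add_index' (by simp) (by simp [pow_add]),
    Finsupp.prod_single_index (by simp), Finsupp.prod_single_index (by simp), pow_one,
    Algebra.smul_def]
  rfl

theorem phiHat_inl (a : Fin C.gr) : C.phiHat (.inl a) = C.x ^ (a : ℕ) * C.y := by
  rw [phiHat, phiMono_inl, toFun_monomial, one_smul]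
  rfl

theorem phiHat_inr (a : Fin C.gs) : C.phiHat (.inr a) = C.x ^ (a : ℕ) * C.z := by
  rw [phiHat, phiMono_inr, toFun_monomial, one_smul]
  rfl

theorem toFun_piHat_inl (a : Fin C.gr) : C.toFun (C.piHat (.inl a)) =
    -(C.z * ∑ n ∈ Finset.range (C.s + C.r), C.drsCoeff a n • C.x ^ n) := by
  rw [piHat_inl, map_neg, map_sum, Finset.mul_sum]
  congr 1
  refine Finset.sum_congr rfl fun n _ => ?_
  rw [toFun_monomial, mul_smul_comm, mul_comm]
  rfl

theorem toFun_piHat_inr (a : Fin C.gs) : C.toFun (C.piHat (.inr a)) =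
    C.y * ∑ m ∈ Finset.range (C.s + C.r), C.drsCoeff m a • C.x ^ m := by
  rw [piHat_inr, map_sum, Finset.mul_sum]
  refine Finset.sum_congr rfl fun n _ => ?_
  rw [toFun_monomial, mul_smul_comm, mul_comm]
  rfl


/-! ### Poles of the explicit representatives -/

variable {C} in
/-- A differential `P(x) dx / u` with `deg P` large is of the second kind with a single pole at
infinity. -/
theorem IsRadicalPair.isSecondKind_and_hasOnlyPoleAtInfinity {u w : C.K} {a b : ℂ[X]}
    (h : C.IsRadicalPair u w a b) {P : ℂ[X]} (hP0 : P ≠ 0)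
    (hP : (a ^ 2 * b).natDegree ≤ 3 * P.natDegree + 3) :
    C.IsSecondKind ((aeval C.x P * u⁻¹) • C.dx) ∧
      C.HasOnlyPoleAtInfinity ((aeval C.x P * u⁻¹) • C.dx) := by
  have hfin : ∀ V, C.IsPlace V → C.x ∈ V → C.IsRegularAt V ((aeval C.x P * u⁻¹) • C.dx) := by
    intro V hV hx
    rw [mul_smul]
    exact (h.isRegularAt_of_mem hV hx).smul (aeval_mem hV hx P)
  refine ⟨fun V hV => ?_, fun V hV => ⟨fun hreg => ?_, hfin V hV⟩⟩
  · by_cases hx : C.x ∈ V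
    · refine ⟨0, ?_⟩
      rw [map_zero, sub_zero]
      exact hfin V hV hx
    · exact h.exists_isRegularAt_sub_D hV hx P
  · by_contra hx
    exact h.not_isRegularAt hV hx hP0 hP hreg

theorem z_ne_zero : C.z ≠ 0 := C.isRadicalPair_z_y.ne_zero

theorem y_ne_zero : C.y ≠ 0 := C.isRadicalPair_y_z.ne_zero

/-- The polynomial in `x` whose quotient by `y` is `π̂_i(D̂) / (3 y z)`, for `φ̂_i = x ^ a y`. -/
noncomputable def repInl (a : ℕ) : ℂ[X] :=
  ∑ n ∈ Finset.range (C.s + C.r), monomial n (-(1 / 3) * C.drsCoeff a n)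

/-- The polynomial in `x` whose quotient by `z` is `π̂_i(D̂) / (3 y z)`, for `φ̂_i = x ^ a z`. -/
noncomputable def repInr (a : ℕ) : ℂ[X] :=
  ∑ m ∈ Finset.range (C.s + C.r), monomial m ((1 / 3) * C.drsCoeff m a)

theorem nuRep_inl (a : Fin C.gr) :
    C.nuRep (.inl a) = (aeval C.x (C.repInl a) * C.y⁻¹) • C.dx := by
  have hy := C.y_ne_zero
  have hz := C.z_ne_zero
  rw [nuRep, toFun_piHat_inl]
  congr 1
  have : aeval C.x (C.repInl a) =
      -(1 / 3) * ∑ n ∈ Finset.range (C.s + C.r), C.drsCoeff a n • C.x ^ n := by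
    rw [repInl, map_sum, Finset.mul_sum]
    refine Finset.sum_congr rfl fun n _ => ?_
    rw [aeval_monomial, map_mul, Algebra.smul_def, map_neg, map_div₀, map_one, map_ofNat, mul_assoc]
  rw [this]
  field_simp

theorem nuRep_inr (a : Fin C.gs) :
    C.nuRep (.inr a) = (aeval C.x (C.repInr a) * C.z⁻¹) • C.dx := by
  have hy := C.y_ne_zero
  have hz := C.z_ne_zero
  rw [nuRep, toFun_piHat_inr]
  congr 1
  have : aeval C.x (C.repInr a) =
      1 / 3 * ∑ m ∈ Finset.range (C.s + C.r), C.drsCoeff m a • C.x ^ m := by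
    rw [repInr, map_sum, Finset.mul_sum]
    refine Finset.sum_congr rfl fun n _ => ?_
    rw [aeval_monomial, map_mul, Algebra.smul_def, map_div₀, map_one, map_ofNat, mul_assoc]
  rw [this]
  field_simp

theorem coeff_repInl_ne_zero {a n : ℕ} (h : a + n + 2 = C.s + C.r) :
    (C.repInl a).coeff n ≠ 0 := by
  have hn : n < C.s + C.r := by omega
  simp only [repInl, finsetSum_coeff, coeff_monomial, Finset.sum_ite_eq', Finset.mem_range, hn,
    if_true]
  exact mul_ne_zero (by norm_num) (C.drsCoeff_top_ne_zero h)

theorem coeff_repInr_ne_zero {a m : ℕ} (h : m + a + 2 = C.s + C.r) :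
    (C.repInr a).coeff m ≠ 0 := by
  have hm : m < C.s + C.r := by omega
  simp only [repInr, finsetSum_coeff, coeff_monomial, Finset.sum_ite_eq', Finset.mem_range, hm,
    if_true]
  exact mul_ne_zero (by norm_num) (C.drsCoeff_top_ne_zero h)

theorem nuRep_isSecondKind_and_hasOnlyPoleAtInfinity (i : C.Idx) :
    C.IsSecondKind (C.nuRep i) ∧ C.HasOnlyPoleAtInfinity (C.nuRep i) := by
  rcases i with a | a
  · have ha : (a : ℕ) < (2 * C.s + C.r - 1) / 3 := a.2
    have hc := C.coeff_repInl_ne_zero (a := a) (n := C.s + C.r - 2 - a) (by omega)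
    rw [nuRep_inl]
    refine C.isRadicalPair_y_z.isSecondKind_and_hasOnlyPoleAtInfinity (fun h0 => ?_) ?_
    · simp [h0] at hc
    · have := le_natDegree_of_ne_zero hc
      rw [natDegree_kr_sq_mul_ks]
      omega
  · have ha : (a : ℕ) < (2 * C.r + C.s - 1) / 3 := a.2
    have hc := C.coeff_repInr_ne_zero (a := a) (m := C.s + C.r - 2 - a) (by omega)
    rw [nuRep_inr]
    refine C.isRadicalPair_z_y.isSecondKind_and_hasOnlyPoleAtInfinity (fun h0 => ?_) ?_
    · simp [h0] at hc
    · have := le_natDegree_of_ne_zero hc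
      rw [natDegree_ks_sq_mul_kr]
      omega

variable {C} in
theorem IsRadicalPair.isRegularAt_pow_of_isPlace {u w : C.K} {a b : ℂ[X]}
    (h : C.IsRadicalPair u w a b) {V : ValuationSubring C.K} (hV : C.IsPlace V) {m : ℕ}
    (hm : 3 * m + 3 ≤ (a ^ 2 * b).natDegree) :
    C.IsRegularAt V ((C.x ^ m * u⁻¹) • C.dx) := by
  by_cases hx : C.x ∈ V
  · rw [mul_smul]
    exact (h.isRegularAt_of_mem hV hx).smul (V.toSubring.pow_mem hx m)
  · exact h.isRegularAt_pow hV hx hm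

variable {C} in
theorem IsRegularAt.algebraMap_smul {V : ValuationSubring C.K} (hV : C.IsPlace V)
    {ω : Ω[C.K⁄ℂ]} (hω : C.IsRegularAt V ω) (c : ℂ) : C.IsRegularAt V (c • ω) := by
  rw [← IsScalarTower.algebraMap_smul C.K c ω]
  exact hω.smul (hV.1 c)

/-- The differentials `ν^I` are holomorphic. -/
theorem isRegularAt_nuI {V : ValuationSubring C.K} (hV : C.IsPlace V) (i : C.Idx) :
    C.IsRegularAt V (C.nuI i) := by
  have hy := C.y_ne_zero
  have hz := C.z_ne_zero
  have h13 : algebraMap ℂ C.K (1 / 3) = 1 / 3 := by rw [map_div₀, map_one, map_ofNat]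
  rcases i with a | a
  · have ha : (a : ℕ) < (2 * C.s + C.r - 1) / 3 := a.2
    have h : C.nuI (.inl a) = (1 / 3 : ℂ) • (C.x ^ (a : ℕ) * C.z⁻¹) • C.dx := by
      rw [nuI, nuICoeff, phiHat_inl, ← IsScalarTower.algebraMap_smul C.K (1 / 3 : ℂ), smul_smul,
        h13]
      congr 1
      field_simp
    rw [h]
    refine IsRegularAt.algebraMap_smul hV (C.isRadicalPair_z_y.isRegularAt_pow_of_isPlace hV ?_) _
    rw [natDegree_ks_sq_mul_kr]
    omega
  · have ha : (a : ℕ) < (2 * C.r + C.s - 1) / 3 := a.2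
    have h : C.nuI (.inr a) = (1 / 3 : ℂ) • (C.x ^ (a : ℕ) * C.y⁻¹) • C.dx := by
      rw [nuI, nuICoeff, phiHat_inr, ← IsScalarTower.algebraMap_smul C.K (1 / 3 : ℂ), smul_smul,
        h13]
      congr 1
      field_simp
    rw [h]
    refine IsRegularAt.algebraMap_smul hV (C.isRadicalPair_y_z.isRegularAt_pow_of_isPlace hV ?_) _
    rw [natDegree_kr_sq_mul_ks]
    omega

variable {C} in
/-- Adding a holomorphic differential changes neither the residues nor the places of the poles. -/
theorem isSecondKind_and_hasOnlyPoleAtInfinity_sub {ω η : Ω[C.K⁄ℂ]}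
    (hω : C.IsSecondKind ω ∧ C.HasOnlyPoleAtInfinity ω)
    (hη : ∀ V, C.IsPlace V → C.IsRegularAt V η) :
    C.IsSecondKind (ω - η) ∧ C.HasOnlyPoleAtInfinity (ω - η) := by
  refine ⟨fun V hV => ?_, fun V hV => ⟨fun h => ?_, fun h => ?_⟩⟩
  · obtain ⟨f, hf⟩ := hω.1 V hV
    refine ⟨f, ?_⟩
    rw [sub_right_comm]
    exact hf.sub (hη V hV)
  · refine (hω.2 V hV).mp ?_
    have := h.add (hη V hV)
    rwa [sub_add_cancel] at this
  · exact ((hω.2 V hV).mpr h).sub (hη V hV)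

/-! ### The derivative of `Σ` -/

theorem ddx_y : C.ddx C.y = C.y * (2 * aeval C.x (derivative C.kr) * aeval C.x C.ks +
    aeval C.x C.kr * aeval C.x (derivative C.ks)) / (3 * aeval C.x C.kr * aeval C.x C.ks) := by
  have hr := C.aeval_x_ne_zero C.kr_ne_zero
  have hs := C.aeval_x_ne_zero C.ks_ne_zero
  rw [C.isRadicalPair_y_z.ddx_eq]
  simp only [derivative_mul, derivative_pow, map_mul, map_add, map_pow, map_natCast]
  push_cast
  field_simp

theorem ddx_z : C.ddx C.z = C.z * (2 * aeval C.x (derivative C.ks) * aeval C.x C.kr +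
    aeval C.x C.ks * aeval C.x (derivative C.kr)) / (3 * aeval C.x C.kr * aeval C.x C.ks) := by
  have hr := C.aeval_x_ne_zero C.kr_ne_zero
  have hs := C.aeval_x_ne_zero C.ks_ne_zero
  rw [C.isRadicalPair_z_y.ddx_eq]
  simp only [derivative_mul, derivative_pow, map_mul, map_add, map_pow, map_natCast]
  push_cast
  field_simp

theorem atP_x_ne_atQ_x : C.atP C.x - C.atQ C.x ≠ 0 := by
  intro h
  obtain ⟨ℓ, hℓ⟩ := C.exists_linearMap_D_atQ
  have h1 := hℓ C.x
  rw [← sub_eq_zero.mp h, D_atP, map_zero, ddx_x, map_one] at h1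
  exact zero_ne_one h1

/-- The derivative of the coefficient of `Σ(P, Q)` with respect to `x_Q`. -/
noncomputable def sigmaDeriv : C.K₂ :=
  (C.atP C.y * C.atQ (C.ddx C.z) + C.atQ (C.ddx C.y) * C.atP C.z +
      3 * C.sigma * C.atP C.y * C.atP C.z) /
    (3 * (C.atP C.x - C.atQ C.x) * C.atP C.y * C.atP C.z)

theorem hasPartialQ_sigma : C.HasPartialQ C.sigma C.sigmaDeriv := by
  have hy : C.atP C.y ≠ 0 := by simpa using C.y_ne_zero
  have hz : C.atP C.z ≠ 0 := by simpa using C.z_ne_zero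
  have hx := C.atP_x_ne_atQ_x
  set W := 3 * (C.atP C.x - C.atQ C.x) * C.atP C.y * C.atP C.z with hW
  have hW0 : W ≠ 0 := mul_ne_zero (mul_ne_zero (mul_ne_zero three_ne_zero hx) hy) hz
  have hσ : C.sigma * W =
      C.atP C.y * C.atP C.z + C.atP C.y * C.atQ C.z + C.atQ C.y * C.atP C.z :=
    div_mul_cancel₀ _ hW0
  have hDW : KaehlerDifferential.D C.K C.K₂ W =
      (-3 * C.atP C.y * C.atP C.z) • KaehlerDifferential.D C.K C.K₂ (C.atQ C.x) := by
    have h3 : (3 : C.K₂) = C.atP 3 := (map_ofNat C.atP 3).symm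
    rw [hW, h3]
    simp only [Derivation.leibniz, D_atP, map_sub, smul_zero, zero_add, add_zero, zero_sub,
      smul_neg, smul_smul, ← neg_smul]
    congr 1
    ring
  have hD := congrArg (KaehlerDifferential.D C.K C.K₂) hσ
  rw [Derivation.leibniz, hDW] at hD
  simp only [map_add, Derivation.leibniz, D_atP, smul_zero, zero_add, add_zero] at hD
  rw [D_atQ_of_pow_three C C.isRadicalPair_y_z.monic.ne_zero C.isRadicalPair_y_z.pow_three,
    D_atQ_of_pow_three C C.isRadicalPair_z_y.monic.ne_zero C.isRadicalPair_z_y.pow_three] at hD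
  simp only [smul_smul, ← add_smul] at hD
  have h2 : W • KaehlerDifferential.D C.K C.K₂ C.sigma =
      (W * C.sigmaDeriv) • KaehlerDifferential.D C.K C.K₂ (C.atQ C.x) := by
    rw [sigmaDeriv, mul_div_cancel₀ _ hW0, ← sub_eq_iff_eq_add'.mpr hD.symm, ← sub_smul]
    congr 1
    ring
  exact smul_right_injective _ hW0 (h2.trans (mul_smul _ _ _))

/-- The identity of rational functions behind `sigmaDeriv_sub_swap`. -/
theorem sigmaDeriv_sub_swap_aux {F : Type*} [Field F] [CharZero F]
    {xP yP zP xQ yQ zQ rP sP rQ sQ rP' sP' rQ' sQ' D₁ D₂ : F}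
    (hx : xP - xQ ≠ 0) (hyP : yP ≠ 0) (hyQ : yQ ≠ 0) (hrP : rP ≠ 0) (hsP : sP ≠ 0) (hrQ : rQ ≠ 0)
    (hsQ : sQ ≠ 0) (hP : yP * zP = rP * sP) (hQ : yQ * zQ = rQ * sQ)
    (hD₁ : (xP - xQ) ^ 2 * D₁ = 3 * (sQ * rQ - sP * rP) + (xP - xQ) *
      (sP' * rP + sP * rP' + (sQ' * rQ + sQ * rQ') + sP * rP' + rQ * sQ'))
    (hD₂ : (xQ - xP) ^ 2 * D₂ = 3 * (sP * rP - sQ * rQ) + (xQ - xP) *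
      (sQ' * rQ + sQ * rQ' + (sP' * rP + sP * rP') + sQ * rQ' + rP * sP')) :
    (yP * (zQ * (2 * sQ' * rQ + sQ * rQ') / (3 * rQ * sQ)) +
        yQ * (2 * rQ' * sQ + rQ * sQ') / (3 * rQ * sQ) * zP +
        3 * ((yP * zP + yP * zQ + yQ * zP) / (3 * (xP - xQ) * yP * zP)) * yP * zP) /
          (3 * (xP - xQ) * yP * zP) -
      (yQ * (zP * (2 * sP' * rP + sP * rP') / (3 * rP * sP)) +
        yP * (2 * rP' * sP + rP * sP') / (3 * rP * sP) * zQ +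
        3 * ((yQ * zQ + yQ * zP + yP * zQ) / (3 * (xQ - xP) * yQ * zQ)) * yQ * zQ) /
          (3 * (xQ - xP) * yQ * zQ) =
    (yP * zQ * D₁ - yQ * zP * D₂) / (3 * yP * zP * (3 * yQ * zQ)) := by
  obtain ⟨δ, rfl⟩ : ∃ δ, xP = xQ + δ := ⟨xP - xQ, by ring⟩
  rw [add_sub_cancel_left] at hx hD₁
  rw [show xQ - (xQ + δ) = -δ by ring] at hD₂ ⊢
  rw [add_sub_cancel_left]
  obtain rfl : zP = rP * sP / yP := by rw [eq_div_iff hyP, mul_comm, hP]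
  obtain rfl : zQ = rQ * sQ / yQ := by rw [eq_div_iff hyQ, mul_comm, hQ]
  have e₁ : D₁ = (3 * (sQ * rQ - sP * rP) + δ *
      (sP' * rP + sP * rP' + (sQ' * rQ + sQ * rQ') + sP * rP' + rQ * sQ')) / δ ^ 2 := by
    rw [eq_div_iff (pow_ne_zero 2 hx), mul_comm, hD₁]
  have e₂ : D₂ = (3 * (sP * rP - sQ * rQ) - δ *
      (sQ' * rQ + sQ * rQ' + (sP' * rP + sP * rP') + sQ * rQ' + rP * sP')) / δ ^ 2 := by
    rw [eq_div_iff (pow_ne_zero 2 hx)]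
    linear_combination hD₂
  rw [e₁, e₂]
  field_simp
  ring

/-- The antisymmetrization of the derivative of `Σ` is given by the polynomial `D̂`. -/
theorem sigmaDeriv_sub_swap : C.sigmaDeriv - C.swap C.sigmaDeriv =
    (C.atP C.y * C.atQ C.z * C.Drs (C.atP C.x) (C.atQ C.x) -
      C.atQ C.y * C.atP C.z * C.Drs (C.atQ C.x) (C.atP C.x)) /
        (3 * C.atP C.y * C.atP C.z * (3 * C.atQ C.y * C.atQ C.z)) := by
  have hyz := C.y_mul_z
  have hr := C.aeval_x_ne_zero C.kr_ne_zero
  have hs := C.aeval_x_ne_zero C.ks_ne_zero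
  have hx := C.atP_x_ne_atQ_x
  have hPQ := C.sq_sub_mul_Drs (C.atP C.x) (C.atQ C.x)
  have hQP := C.sq_sub_mul_Drs (C.atQ C.x) (C.atP C.x)
  simp only [derivative_mul, map_add, map_mul, aeval_algHom_apply] at hPQ hQP
  simp only [sigmaDeriv, sigma, ddx_y, ddx_z, map_div₀, map_mul, map_add, map_sub, map_ofNat,
    swap_atP, swap_atQ]
  have hyzP : C.atP C.y * C.atP C.z = C.atP (aeval C.x C.kr) * C.atP (aeval C.x C.ks) := by
    rw [← map_mul, hyz, map_mul]
  have hyzQ : C.atQ C.y * C.atQ C.z = C.atQ (aeval C.x C.kr) * C.atQ (aeval C.x C.ks) := by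
    rw [← map_mul, hyz, map_mul]
  have hrP : C.atP (aeval C.x C.kr) ≠ 0 := by rwa [ne_eq, map_eq_zero]
  have hsP : C.atP (aeval C.x C.ks) ≠ 0 := by rwa [ne_eq, map_eq_zero]
  have hrQ : C.atQ (aeval C.x C.kr) ≠ 0 := by rwa [ne_eq, map_eq_zero]
  have hsQ : C.atQ (aeval C.x C.ks) ≠ 0 := by rwa [ne_eq, map_eq_zero]
  have hyP : C.atP C.y ≠ 0 := by simpa using C.y_ne_zero
  have hyQ : C.atQ C.y ≠ 0 := by simpa using C.y_ne_zero
  exact sigmaDeriv_sub_swap_aux hx hyP hyQ hrP hsP hrQ hsQ hyzP hyzQ hPQ hQP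

/-! ### The relation for the explicit representatives -/

theorem sum_range_sum_eq_sum_ite {A : Type*} [AddCommMonoid A] (F : ℕ → ℕ → A) {k N : ℕ}
    (s : Finset ℕ) (h : k ≤ N) :
    ∑ i ∈ Finset.range k, ∑ j ∈ s, F i j =
      ∑ i ∈ Finset.range N, ∑ j ∈ s, if i < k then F i j else 0 := by
  rw [← Finset.sum_subset (Finset.range_mono h)]
  · refine Finset.sum_congr rfl fun i hi => ?_
    simp only [Finset.mem_range.mp hi, if_true]
  · intro i _ hi
    rw [Finset.mem_range] at hi
    simp only [hi, if_false, Finset.sum_const_zero]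

section

variable {A : Type} [CommRing A] [Algebra ℂ A]

/-- Every monomial `x_P ^ m x_Q ^ n` of `D` has `m < g_r` or `n < g_s`, as its degree is at most
`g_r + g_s - 1`. -/
theorem sum_drsCoeff_add_sum_drsCoeff (p q : A) :
    ∑ n ∈ Finset.range C.gs, ∑ m ∈ Finset.range (C.s + C.r), C.drsCoeff m n • (p ^ m * q ^ n) +
      ∑ m ∈ Finset.range C.gr, ∑ n ∈ Finset.range (C.s + C.r), C.drsCoeff m n • (p ^ m * q ^ n) =
    C.Drs p q +
      ∑ n ∈ Finset.range C.gs, ∑ m ∈ Finset.range C.gr, C.drsCoeff m n • (p ^ m * q ^ n) := by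
  have hg := C.gr_add_gs
  have hr : C.gr ≤ C.s + C.r := by omega
  have hs : C.gs ≤ C.s + C.r := by omega
  let f : ℕ → ℕ → A := fun m n => C.drsCoeff m n • (p ^ m * q ^ n)
  have e₁ : ∑ n ∈ Finset.range C.gs, ∑ m ∈ Finset.range (C.s + C.r), f m n =
      ∑ n ∈ Finset.range (C.s + C.r), ∑ m ∈ Finset.range (C.s + C.r),
        if n < C.gs then f m n else 0 :=
    sum_range_sum_eq_sum_ite (fun n m => f m n) _ hs
  have e₂ : ∑ m ∈ Finset.range C.gr, ∑ n ∈ Finset.range (C.s + C.r), f m n =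
      ∑ n ∈ Finset.range (C.s + C.r), ∑ m ∈ Finset.range (C.s + C.r),
        if m < C.gr then f m n else 0 :=
    (sum_range_sum_eq_sum_ite f _ hr).trans Finset.sum_comm
  have e₃ : ∑ n ∈ Finset.range C.gs, ∑ m ∈ Finset.range C.gr, f m n =
      ∑ n ∈ Finset.range (C.s + C.r), ∑ m ∈ Finset.range (C.s + C.r),
        if n < C.gs then (if m < C.gr then f m n else 0) else 0 := by
    rw [Finset.sum_comm, sum_range_sum_eq_sum_ite f _ hr, Finset.sum_comm]
    exact sum_range_sum_eq_sum_ite (fun n m => if m < C.gr then f m n else 0) _ hs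
  have e₄ : C.Drs p q = ∑ n ∈ Finset.range (C.s + C.r), ∑ m ∈ Finset.range (C.s + C.r), f m n :=
    C.Drs_eq_sum p q
  change ∑ n ∈ Finset.range C.gs, ∑ m ∈ Finset.range (C.s + C.r), f m n +
    ∑ m ∈ Finset.range C.gr, ∑ n ∈ Finset.range (C.s + C.r), f m n = C.Drs p q +
      ∑ n ∈ Finset.range C.gs, ∑ m ∈ Finset.range C.gr, f m n
  rw [e₁, e₂, e₃, e₄, ← Finset.sum_add_distrib, ← Finset.sum_add_distrib]
  refine Finset.sum_congr rfl fun n _ => ?_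
  rw [← Finset.sum_add_distrib, ← Finset.sum_add_distrib]
  refine Finset.sum_congr rfl fun m _ => ?_
  split_ifs with hn hm hm
  · rfl
  · rfl
  · rw [zero_add, add_zero]
  · simp only [f]
    rw [C.drsCoeff_eq_zero (by omega), zero_smul]

/-- The functions `φ̂` as polynomials in the coordinates. -/
noncomputable def phiVal (x y z : A) : C.Idx → A :=
  Sum.elim (fun a => x ^ (a : ℕ) * y) (fun a => x ^ (a : ℕ) * z)

/-- The coefficients `π̂_i(D̂)` as polynomials in the coordinates. -/
noncomputable def piVal (x y z : A) : C.Idx → A :=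
  Sum.elim (fun a => -(z * ∑ n ∈ Finset.range (C.s + C.r), C.drsCoeff a n • x ^ n))
    (fun a => y * ∑ m ∈ Finset.range (C.s + C.r), C.drsCoeff m a • x ^ m)

theorem sum_phiVal_mul_piVal (xP yP zP xQ yQ zQ : A) :
    ∑ i, C.phiVal xQ yQ zQ i * C.piVal xP yP zP i =
      yP * zQ * ∑ n ∈ Finset.range C.gs, ∑ m ∈ Finset.range (C.s + C.r),
        C.drsCoeff m n • (xP ^ m * xQ ^ n) -
      yQ * zP * ∑ m ∈ Finset.range C.gr, ∑ n ∈ Finset.range (C.s + C.r),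
        C.drsCoeff m n • (xQ ^ m * xP ^ n) := by
  rw [Fintype.sum_sum_type, add_comm, sub_eq_add_neg]
  congr 1
  · rw [← Fin.sum_univ_eq_sum_range (fun n => ∑ m ∈ Finset.range (C.s + C.r),
      C.drsCoeff m n • (xP ^ m * xQ ^ n)), Finset.mul_sum]
    refine Finset.sum_congr rfl fun a _ => ?_
    simp only [phiVal, piVal, Sum.elim_inr, Finset.mul_sum, mul_smul_comm]
    refine Finset.sum_congr rfl fun m _ => ?_
    congr 1
    ring
  · rw [← Fin.sum_univ_eq_sum_range (fun m => ∑ n ∈ Finset.range (C.s + C.r),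
      C.drsCoeff m n • (xQ ^ m * xP ^ n)), Finset.mul_sum, ← Finset.sum_neg_distrib]
    refine Finset.sum_congr rfl fun a _ => ?_
    simp only [phiVal, piVal, Sum.elim_inl, Finset.mul_sum, mul_smul_comm, mul_neg]
    congr 1
    refine Finset.sum_congr rfl fun m _ => ?_
    congr 1
    ring

theorem sum_piHat₂_smul_phiVal_mul_phiVal (xP yP zP xQ yQ zQ : A) :
    ∑ i, C.phiVal xQ yQ zQ i * ∑ j, C.piHat₂ i j • C.phiVal xP yP zP j =
      yP * zQ * ∑ n ∈ Finset.range C.gs, ∑ m ∈ Finset.range C.gr,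
        C.drsCoeff m n • (xP ^ m * xQ ^ n) -
      yQ * zP * ∑ n ∈ Finset.range C.gs, ∑ m ∈ Finset.range C.gr,
        C.drsCoeff m n • (xQ ^ m * xP ^ n) := by
  simp only [← Fin.sum_univ_eq_sum_range]
  rw [Fintype.sum_sum_type, add_comm, sub_eq_add_neg]
  congr 1
  · rw [Finset.mul_sum]
    refine Finset.sum_congr rfl fun a _ => ?_
    simp only [Fintype.sum_sum_type, piHat₂_inr_inl, piHat₂_inr_inr, zero_smul,
      Finset.sum_const_zero, add_zero, phiVal, Sum.elim_inl, Sum.elim_inr, Finset.mul_sum,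
      mul_smul_comm]
    refine Finset.sum_congr rfl fun b _ => ?_
    congr 1
    ring
  · rw [Finset.sum_comm, Finset.mul_sum, ← Finset.sum_neg_distrib]
    refine Finset.sum_congr rfl fun a _ => ?_
    simp only [Fintype.sum_sum_type, piHat₂_inl_inl, piHat₂_inl_inr, zero_smul, neg_smul,
      Finset.sum_const_zero, zero_add, phiVal, Sum.elim_inl, Sum.elim_inr, Finset.mul_sum,
      mul_smul_comm, mul_neg, Finset.sum_neg_distrib]
    congr 1
    refine Finset.sum_congr rfl fun b _ => ?_
    congr 1
    ring

/-- The decomposition of the antisymmetric polynomial `D̂`. The monomials that are products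
`φ̂_i(Q) φ̂_j(P)` occur in two of the sums, which the terms with the factor `1 / 2` make up for. -/
theorem sum_phiVal_mul_sub (xP yP zP xQ yQ zQ : A) :
    ∑ i, (C.phiVal xQ yQ zQ i *
          (C.piVal xP yP zP i - (1 / 2 : ℂ) • ∑ j, C.piHat₂ i j • C.phiVal xP yP zP j) -
        C.phiVal xP yP zP i *
          (C.piVal xQ yQ zQ i - (1 / 2 : ℂ) • ∑ j, C.piHat₂ i j • C.phiVal xQ yQ zQ j)) =
      yP * zQ * C.Drs xP xQ - yQ * zP * C.Drs xQ xP := by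
  simp only [mul_sub, mul_smul_comm, Finset.sum_sub_distrib, ← Finset.smul_sum]
  rw [sum_phiVal_mul_piVal, sum_phiVal_mul_piVal, sum_piHat₂_smul_phiVal_mul_phiVal,
    sum_piHat₂_smul_phiVal_mul_phiVal]
  have h1 := C.sum_drsCoeff_add_sum_drsCoeff xP xQ
  have h2 := C.sum_drsCoeff_add_sum_drsCoeff xQ xP
  have ht : algebraMap ℂ A (1 / 2) * 2 = 1 := by
    rw [← map_ofNat (algebraMap ℂ A) 2, ← map_mul]
    norm_num
  simp only [Algebra.smul_def (1 / 2 : ℂ)]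
  generalize ∑ n ∈ Finset.range C.gs, ∑ m ∈ Finset.range C.gr,
    C.drsCoeff m n • (xP ^ m * xQ ^ n) = B₁ at *
  generalize ∑ n ∈ Finset.range C.gs, ∑ m ∈ Finset.range C.gr,
    C.drsCoeff m n • (xQ ^ m * xP ^ n) = B₂ at *
  linear_combination yP * zQ * h1 - yQ * zP * h2 - (yP * zQ * B₁ - yQ * zP * B₂) * ht

end

theorem map_phiHat {A : Type} [CommRing A] [Algebra ℂ A] (φ : C.K →ₐ[ℂ] A) (i : C.Idx) :
    φ (C.phiHat i) = C.phiVal (φ C.x) (φ C.y) (φ C.z) i := by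
  rcases i with a | a
  · rw [phiHat_inl, map_mul, map_pow]; rfl
  · rw [phiHat_inr, map_mul, map_pow]; rfl

theorem map_toFun_piHat {A : Type} [CommRing A] [Algebra ℂ A] (φ : C.K →ₐ[ℂ] A) (i : C.Idx) :
    φ (C.toFun (C.piHat i)) = C.piVal (φ C.x) (φ C.y) (φ C.z) i := by
  rcases i with a | a
  · rw [toFun_piHat_inl, map_neg, map_mul, map_sum]
    simp only [map_smul, map_pow]
    rfl
  · rw [toFun_piHat_inr, map_mul, map_sum]
    simp only [map_smul, map_pow]
    rfl

theorem map_smul_sum_piHat₂ {A : Type} [CommRing A] [Algebra ℂ A] (φ : C.K →ₐ[ℂ] A) (i : C.Idx) :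
    φ ((1 / 2 : ℂ) • ∑ j, C.piHat₂ i j • C.phiHat j) =
      (1 / 2 : ℂ) • ∑ j, C.piHat₂ i j • C.phiVal (φ C.x) (φ C.y) (φ C.z) j := by
  simp only [map_smul, map_sum, map_phiHat]

/-- The coefficient with respect to `dx` of the differential `ν̃_i - ½ ∑ c_ij ν^I_j`. -/
noncomputable def nuExactCoeff (i : C.Idx) : C.K :=
  (C.toFun (C.piHat i) - (1 / 2 : ℂ) • ∑ j, C.piHat₂ i j • C.phiHat j) / (3 * C.y * C.z)

theorem nuRep_sub_eq (i : C.Idx) :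
    C.nuRep i - (1 / 2 : ℂ) • ∑ j, C.piHat₂ i j • C.nuI j = C.nuExactCoeff i • C.dx := by
  have h : ∀ j, C.piHat₂ i j • C.nuI j = (C.piHat₂ i j • C.nuICoeff j) • C.dx := fun j =>
    (smul_assoc _ _ _).symm
  simp only [h, ← Finset.sum_smul]
  rw [← smul_assoc, nuRep, ← sub_smul, nuExactCoeff, sub_div, smul_div_assoc, Finset.sum_div]
  simp only [nuICoeff, smul_div_assoc]

theorem dSigmaRelation_nuRep_sub :
    C.DSigmaRelation (fun i => C.nuRep i - (1 / 2 : ℂ) • ∑ j, C.piHat₂ i j • C.nuI j) := by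
  refine ⟨C.nuExactCoeff, C.sigmaDeriv, C.nuRep_sub_eq, C.hasPartialQ_sigma, ?_⟩
  rw [sigmaDeriv_sub_swap, ← sum_phiVal_mul_sub, Finset.sum_div]
  refine Finset.sum_congr rfl fun i _ => ?_
  simp only [nuExactCoeff, nuICoeff, map_div₀, map_mul, map_sub, map_ofNat, map_phiHat,
    map_toFun_piHat, map_smul_sum_piHat₂]
  rw [div_mul_div_comm, div_mul_div_comm, mul_comm (3 * C.atQ C.y * C.atQ C.z), ← sub_div]

/-! ### Uniqueness -/

theorem aeval_x_injective : Function.Injective (aeval C.x : ℂ[X] →ₐ[ℂ] C.K) := by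
  rw [injective_iff_map_eq_zero]
  intro p hp
  by_contra h
  exact C.aeval_x_ne_zero h hp

/-- The functions `y` and `z` are linearly independent over the polynomials in `x`, as the cubes of
`p y` and of `q z` have different degrees modulo `3`. -/
theorem eq_zero_of_mul_y_add_mul_z {p q : ℂ[X]} (h : aeval C.x p * C.y + aeval C.x q * C.z = 0) :
    p = 0 ∧ q = 0 := by
  have hr := C.kr_ne_zero
  have hs := C.ks_ne_zero
  have h' : p ^ 3 * (C.kr ^ 2 * C.ks) = -(q ^ 3 * (C.ks ^ 2 * C.kr)) := by
    apply C.aeval_x_injective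
    rw [map_neg, map_mul _ (p ^ 3), map_mul _ (q ^ 3), ← C.isRadicalPair_y_z.pow_three,
      ← C.isRadicalPair_z_y.pow_three, map_pow, map_pow, ← mul_pow, ← mul_pow,
      eq_neg_of_add_eq_zero_left h]
    ring
  have hpq : p = 0 ↔ q = 0 := by
    constructor
    · rintro rfl
      rw [map_zero, zero_mul, zero_add] at h
      have := (mul_eq_zero.mp h).resolve_right C.z_ne_zero
      by_contra hq
      exact C.aeval_x_ne_zero hq this
    · rintro rfl
      rw [map_zero, zero_mul, add_zero] at h
      have := (mul_eq_zero.mp h).resolve_right C.y_ne_zero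
      by_contra hp
      exact C.aeval_x_ne_zero hp this
  by_cases hp : p = 0
  · exact ⟨hp, hpq.mp hp⟩
  have hq : q ≠ 0 := fun hq => hp (hpq.mpr hq)
  have hdeg := congrArg natDegree h'
  rw [natDegree_neg, natDegree_mul (pow_ne_zero _ hp) (mul_ne_zero (pow_ne_zero _ hr) hs),
    natDegree_mul (pow_ne_zero _ hq) (mul_ne_zero (pow_ne_zero _ hs) hr), natDegree_pow,
    natDegree_pow, natDegree_kr_sq_mul_ks, natDegree_ks_sq_mul_kr] at hdeg
  have hm := C.mod
  simp only [Nat.ModEq] at hm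
  omega

theorem linearIndependent_nuICoeff : LinearIndependent ℂ C.nuICoeff := by
  rw [Fintype.linearIndependent_iff]
  intro c hc
  have h3 : (3 * C.y * C.z : C.K) ≠ 0 :=
    mul_ne_zero (mul_ne_zero three_ne_zero C.y_ne_zero) C.z_ne_zero
  simp only [nuICoeff, ← smul_div_assoc, ← Finset.sum_div] at hc
  have hc' := (div_eq_zero_iff.mp hc).resolve_right h3
  let p : ℂ[X] := ∑ a : Fin C.gr, monomial (a : ℕ) (c (.inl a))
  let q : ℂ[X] := ∑ a : Fin C.gs, monomial (a : ℕ) (c (.inr a))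
  obtain ⟨hp, hq⟩ := C.eq_zero_of_mul_y_add_mul_z (p := p) (q := q) (by
    rw [← hc', Fintype.sum_sum_type]
    simp only [p, q, map_sum, aeval_monomial, Finset.sum_mul, phiHat_inl, phiHat_inr,
      Algebra.smul_def, mul_assoc])
  rintro (a | a)
  · have := congrArg (fun t => t.coeff (a : ℕ)) hp
    simpa [p, finsetSum_coeff, coeff_monomial, Fin.val_inj] using this
  · have := congrArg (fun t => t.coeff (a : ℕ)) hq
    simpa [q, finsetSum_coeff, coeff_monomial, Fin.val_inj] using this

/-- If `∑ v_i ⊗ u_i` is symmetric, then the `v_i` are combinations of the linearly independent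
`u_i`. -/
theorem mem_span_of_sum_tmul_eq {ι M : Type*} [Fintype ι] [AddCommGroup M] [Module ℂ M]
    {u v : ι → M} (hu : LinearIndependent ℂ u)
    (h : ∑ i, v i ⊗ₜ[ℂ] u i = ∑ i, u i ⊗ₜ[ℂ] v i) (j : ι) :
    v j ∈ Submodule.span ℂ (Set.range u) := by
  classical
  -- Apply a linear form dual to `u j` to the second factor.
  obtain ⟨f, hf⟩ := ((Finsupp.lapply j).comp hu.repr).exists_extend
  have hfu : ∀ i, f (u i) = if i = j then 1 else 0 := by
    intro i
    have := LinearMap.congr_fun hf ⟨u i, Submodule.subset_span ⟨i, rfl⟩⟩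
    simp only [LinearMap.comp_apply, Submodule.subtype_apply] at this
    rw [this, hu.repr_eq_single i _ rfl]
    simp [Finsupp.single_apply]
  have h' := congrArg (TensorProduct.rid ℂ M ∘ LinearMap.lTensor M f) h
  simp only [Function.comp_apply, map_sum, LinearMap.lTensor_tmul, TensorProduct.rid_tmul, hfu,
    ite_smul, one_smul, zero_smul, Finset.sum_ite_eq', Finset.mem_univ, if_true] at h'
  rw [h']
  exact Submodule.sum_mem _ fun i _ => Submodule.smul_mem _ _ (Submodule.subset_span ⟨i, rfl⟩)

theorem sub_mem_span_of_dSigmaRelation {ν ν' : C.Idx → Ω[C.K⁄ℂ]} (hν : C.DSigmaRelation ν)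
    (hν' : C.DSigmaRelation ν') (i : C.Idx) :
    ν i - ν' i ∈ Submodule.span ℂ (Set.range C.nuI) := by
  obtain ⟨h, c, hh, hc, hrel⟩ := hν
  obtain ⟨h', c', hh', hc', hrel'⟩ := hν'
  obtain rfl := C.hasPartialQ_unique hc hc'
  have key : ∑ i, (h i - h' i) ⊗ₜ[ℂ] C.nuICoeff i = ∑ i, C.nuICoeff i ⊗ₜ[ℂ] (h i - h' i) := by
    have hmul : ∀ f g : C.K, algebraMap (C.K ⊗[ℂ] C.K) C.K₂ (f ⊗ₜ g) = C.atP f * C.atQ g := by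
      intro f g
      rw [← mul_one f, ← one_mul g, ← Algebra.TensorProduct.tmul_mul_tmul, map_mul, mul_one,
        one_mul]
      rfl
    apply IsFractionRing.injective (C.K ⊗[ℂ] C.K) C.K₂
    rw [map_sum, map_sum, ← sub_eq_zero, ← Finset.sum_sub_distrib]
    have := sub_eq_zero.mpr (hrel.symm.trans hrel')
    rw [← Finset.sum_sub_distrib] at this
    rw [← this]
    refine Finset.sum_congr rfl fun i _ => ?_
    rw [hmul, hmul, map_sub, map_sub]
    ring
  have hmem := mem_span_of_sum_tmul_eq C.linearIndependent_nuICoeff key i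
  rw [hh, hh', ← sub_smul]
  have := Submodule.mem_map_of_mem (f := ((LinearMap.toSpanSingleton C.K _ C.dx).restrictScalars ℂ))
    hmem
  rw [Submodule.map_span, ← Set.range_comp] at this
  exact this

theorem sum_smul_nuI_mem_span (i : C.Idx) :
    (1 / 2 : ℂ) • ∑ j, C.piHat₂ i j • C.nuI j ∈ Submodule.span ℂ (Set.range C.nuI) :=
  Submodule.smul_mem _ _ <| Submodule.sum_mem _ fun j _ =>
    Submodule.smul_mem _ _ (Submodule.subset_span ⟨j, rfl⟩)

end TrigonalCurve

theorem mainTheorem5 (C : TrigonalCurve) :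
    (∃ ν : C.Idx → Ω[C.K⁄ℂ],
      (∀ i, C.IsSecondKind (ν i) ∧ C.HasOnlyPoleAtInfinity (ν i)) ∧ C.DSigmaRelation ν) ∧
    (∀ ν ν' : C.Idx → Ω[C.K⁄ℂ], C.DSigmaRelation ν → C.DSigmaRelation ν' →
      ∀ i, ν i - ν' i ∈ Submodule.span ℂ (Set.range C.nuI)) ∧
    (∀ i, C.IsSecondKind (C.nuRep i) ∧ C.HasOnlyPoleAtInfinity (C.nuRep i)) ∧
    (∀ ν : C.Idx → Ω[C.K⁄ℂ], C.DSigmaRelation ν →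
      ∀ i, ν i - C.nuRep i ∈ Submodule.span ℂ (Set.range C.nuI)) ∧
    C.DSigmaRelation (fun i => C.nuRep i - (1 / 2 : ℂ) • ∑ j, C.piHat₂ i j • C.nuI j) := by
  have hrel := C.dSigmaRelation_nuRep_sub
  refine ⟨⟨_, fun i => ?_, hrel⟩, fun ν ν' hν hν' => C.sub_mem_span_of_dSigmaRelation hν hν',
    C.nuRep_isSecondKind_and_hasOnlyPoleAtInfinity, fun ν hν i => ?_, hrel⟩
  · refine TrigonalCurve.isSecondKind_and_hasOnlyPoleAtInfinity_sub
      (C.nuRep_isSecondKind_and_hasOnlyPoleAtInfinity i) fun V hV => ?_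
    exact TrigonalCurve.IsRegularAt.algebraMap_smul hV (TrigonalCurve.IsRegularAt.sum fun j _ =>
      TrigonalCurve.IsRegularAt.algebraMap_smul hV (C.isRegularAt_nuI hV j) _) _
  · have h1 := C.sub_mem_span_of_dSigmaRelation hν hrel i
    have h2 := Submodule.sub_mem _ h1 (C.sum_smul_nuI_mem_span i)
    convert h2 using 1
    abel
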